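/- All objects are finite. For a hypergraph $\mathcal H=(V,\mathcal E)$, $\mathrm{MIS}(\mathcal H)$ is the family of inclusion-wise maximal sets $I\subseteq V$ containing no edge, and $\mathrm{MHS}(\mathcal H)$ the family of inclusion-wise minimal sets $T\subseteq V$ meeting every edge. An implicational base $(X,\Sigma)$ is a collection of implications $A\to B$ with $A,B\subseteq X$; a set $C\subseteq X$ is closed if $A\subseteq C$ implies $B\subseteq C$ for every $A\to B$ in $\Sigma$. The closed sets form a closure system $\mathcal C$, and $\Sigma$ is a base of $\mathcal C$. Its implication graph has an arc $ab$ whenever $a\in A$ and $b\in B$ for some $A\to B$ in $\Sigma$; $\Sigma$ is acyclic if this graph is, and its height is then the number of vertices of a longest directed path. A closure system $\mathcal C$ on $X$ is a convex geometry if $\emptyset\in\mathcal C$ and every $C\in\mathcal C$ with $C\ne X$ has some $x\notin C$ with $C\cup\{x\}\in\mathcal C$; it is acyclic if it has an acyclic base. A set $M\in\mathcal C$, $M\neq X$, is irreducible if $M=C\cap C'$ with $C,C'\in\mathcal C$ implies $M\in\{C,C'\}$; $\mathrm{irr}(\mathcal C)$ is the family of these sets, and $\mathrm{irr}(x)$ is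 the family of inclusion-wise maximal closed sets not containing $x$. A unit-minimum base is a base all of whose conclusions are singletons, with the fewest implications among all such bases of $\mathcal C$. Consider the following problems, in which the required items are to be listed without repetition. - MIS-Enum, MHS-Enum: given a hypergraph $\mathcal H$, list $\mathrm{MIS}(\mathcal H)$, respectively $\mathrm{MHS}(\mathcal H)$. - ICS-Enum: given $(X,\Sigma)$, list $\mathrm{irr}(\mathcal C)$. ACS-Enum: given $(X,\Sigma)$ and $x\in X$, list $\mathrm{irr}(x)$. - MIB-Gen: given $X$ and $\mathrm{irr}(\mathcal C)$ for a closure system $\mathcal C$ on $X$, list a unit-minimum base of $\mathcal C$. The size of an input is $|X|$ plus the number of sets or implications given. A problem $P$ is *at least as hard as* a problem $Q$ if (a) there is a polynomial-time reduction from $Q$ to $P$, that is, polynomial-time computable maps $f$ from instances $i$ of $Q$ to instances of $P$ (of polynomially bounded size), and $g$ which, given $i$, turns each output item of $P$ into an item for $i$ or rejects it, such that for every correct answer $S$ to $f(i)$ at most polynomially many members of $S$ are rejected and the others are mapped one-to-one onto a correct answer to $i$; and (b) if $P$ has an output-polynomial (respectively incremental-polynomial, polynomial-delay) time algorithm, then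 so does $Q$. **Theorem.** 1. Let $\mathcal K$ be any class of implicational bases that contains all acyclic bases of height $2$ whose closed sets form a convex geometry (for instance, the class of all bases of acyclic convex geometries, or of those that admit an acyclic base of height $2$). Then ICS-Enum and ACS-Enum, restricted to bases in $\mathcal K$, are both at least as hard as MIS-Enum and as MHS-Enum. 2. Let $\mathcal K$ be any class of closure systems that contains all convex geometries admitting an acyclic base of height $2$ (for instance, the class of all acyclic convex geometries). Then MIB-Gen, restricted to closure systems in $\mathcal K$, is at least as hard as MIS-Enum and as MHS-Enum. 3. Let $\mathcal H=(V,\mathcal E)$ be a hypergraph, $z\notin V$, $X=V\cup\{z\}$ and $\Sigma=\{E\to z: E\in\mathcal E\}$. Then $\Sigma$ is acyclic and $\mathrm{irr}(z)=\mathrm{MIS}(\mathcal H)$. If moreover $\mathcal E\ne\emptyset$ and $\emptyset\notin\mathcal E$, then $\Sigma$ has height $2$ and its closed sets form a convex geometry. -/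

import Mathlib

namespace EnumHardness

/-! ### Model of computation

The WHILE language: a program manipulates finitely many registers that hold binary trees.
The elementary operations are `nil`, `cons`, `hd`, `tl`, the test for `nil`, and the output
of one item; each executed command costs one time unit.  Trees can be shared in memory (no
elementary operation copies or compares a whole tree), so that this model and multitape
Turing machines simulate each other with polynomial overhead. -/

/-- Binary trees, the data of the model. -/
inductive Data : Type
  | nil : Data
  | cons : Data → Data → Data

namespace Data

def hd : Data → Data
  | nil => nil
  | cons a _ => a

def tl : Data → Data
  | nil => nil
  | cons _ b => b

/-- Lists as trees. -/
def ofList : List Data → Data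
  | [] => nil
  | a :: l => cons a (ofList l)

/-- Booleans as trees. -/
def ofBool : Bool → Data
  | false => nil
  | true => cons nil nil

/-- Natural numbers in unary. -/
def ofNat (n : ℕ) : Data := ofList (List.replicate n nil)

/-- A subset of `Fin n` is coded by its characteristic vector, a list of `n` booleans. -/
def ofFinset {n : ℕ} (A : Finset (Fin n)) : Data :=
  ofList ((List.finRange n).map fun i => ofBool (decide (i ∈ A)))

/-- `none` is `nil`, and `some d` is a pair. -/
def ofOption : Option Data → Data
  | none => nil
  | some d => cons nil d

end Data

/-- The contents of the registers. -/
abbrev Store : Type := ℕ → Data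

inductive Expr : Type
  | var : ℕ → Expr
  | nil : Expr
  | cons : Expr → Expr → Expr
  | hd : Expr → Expr
  | tl : Expr → Expr

def Expr.eval (s : Store) : Expr → Data
  | .var r => s r
  | .nil => Data.nil
  | .cons a b => Data.cons (a.eval s) (b.eval s)
  | .hd a => (a.eval s).hd
  | .tl a => (a.eval s).tl

/-- Programs. `emit e` outputs the value of `e`; in `ite e c d` and in `loop e c` the test
is whether the value of `e` is different from `nil`. -/
inductive Cmd : Type
  | skip : Cmd
  | assign : ℕ → Expr → Cmd
  | emit : Expr → Cmd
  | seq : Cmd → Cmd → Cmd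
  | ite : Expr → Cmd → Cmd → Cmd
  | loop : Expr → Cmd → Cmd

/-- A trace records the time steps of a run: `some d` if the item `d` is output at that step,
`none` otherwise.  Its length is the running time. -/
abbrev Trace : Type := List (Option Data)

/-- The items that are output, in order. -/
def outputs (t : Trace) : List Data := t.reduceOption

/-- `Exec c s t s'`: the program `c`, started in the store `s`, halts in the store `s'`
with trace `t`. -/
inductive Exec : Cmd → Store → Trace → Store → Prop
  | skip (s : Store) : Exec .skip s [none] s
  | assign (s : Store) (r : ℕ) (e : Expr) :
      Exec (.assign r e) s [none] (Function.update s r (e.eval s))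
  | emit (s : Store) (e : Expr) : Exec (.emit e) s [some (e.eval s)] s
  | seq {c d : Cmd} {s s' s'' : Store} {t t' : Trace} :
      Exec c s t s' → Exec d s' t' s'' → Exec (.seq c d) s (t ++ t') s''
  | iteTrue {e : Expr} {c d : Cmd} {s s' : Store} {t : Trace} :
      e.eval s ≠ Data.nil → Exec c s t s' → Exec (.ite e c d) s (none :: t) s'
  | iteFalse {e : Expr} {c d : Cmd} {s s' : Store} {t : Trace} :
      e.eval s = Data.nil → Exec d s t s' → Exec (.ite e c d) s (none :: t) s'
  | loopFalse {e : Expr} {c : Cmd} {s : Store} :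
      e.eval s = Data.nil → Exec (.loop e c) s [none] s
  | loopTrue {e : Expr} {c : Cmd} {s s' s'' : Store} {t t' : Trace} :
      e.eval s ≠ Data.nil → Exec c s t s' → Exec (.loop e c) s' t' s'' →
      Exec (.loop e c) s (none :: (t ++ t')) s''

/-- The initial store: the input is in register `0`, all other registers are `nil`. -/
def initStore (d : Data) : Store := Function.update (fun _ => Data.nil) 0 d

/-! ### Enumeration problems and their complexity -/

/-- An enumeration (or generation) problem: for an instance `i`, one has to list without
repetition the members of one set `S` of items with `IsAnswer i S`. -/
structure EnumProblem where
  Inst : Type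
  size : Inst → ℕ
  code : Inst → Data
  Item : Inst → Type
  itemCode : (i : Inst) → Item i → Data
  IsAnswer : (i : Inst) → Set (Item i) → Prop

namespace EnumProblem

/-- The outputs of the trace `t` list, without repetition, a correct answer to `i`. -/
def Correct (P : EnumProblem) (i : P.Inst) (t : Trace) : Prop :=
  ∃ l : List (P.Item i), l.Nodup ∧ P.IsAnswer i {x | x ∈ l} ∧ outputs t = l.map (P.itemCode i)

/-- Some program solves `P`, and its running time is bounded by a polynomial in the combined
sizes of the input and the output. -/
def OutputPoly (P : EnumProblem) : Prop :=
  ∃ (c : Cmd) (p : Polynomial ℕ), ∀ i : P.Inst, ∃ (t : Trace) (s : Store),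
    Exec c (initStore (P.code i)) t s ∧ P.Correct i t ∧
      t.length ≤ p.eval (P.size i + (outputs t).length)

/-- Some program solves `P` such that the `k`-th item is output within a time bounded by a
polynomial in the input size plus `k`, and such that it halts within a time bounded likewise
after its last output. -/
def IncrementalPoly (P : EnumProblem) : Prop :=
  ∃ (c : Cmd) (p : Polynomial ℕ), ∀ i : P.Inst, ∃ (t : Trace) (s : Store),
    Exec c (initStore (P.code i)) t s ∧ P.Correct i t ∧
      (∀ (t₁ t₂ : Trace) (d : Data), t = t₁ ++ some d :: t₂ →
        t₁.length + 1 ≤ p.eval (P.size i + ((outputs t₁).length + 1))) ∧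
      t.length ≤ p.eval (P.size i + ((outputs t).length + 1))

/-- Some program solves `P` such that the time before the first output, between consecutive
outputs, and after the last output is bounded by a polynomial in the input size. -/
def PolyDelay (P : EnumProblem) : Prop :=
  ∃ (c : Cmd) (p : Polynomial ℕ), ∀ i : P.Inst, ∃ (t : Trace) (s : Store),
    Exec c (initStore (P.code i)) t s ∧ P.Correct i t ∧
      ∀ (t₁ t₂ : Trace) (k : ℕ), t = t₁ ++ List.replicate k none ++ t₂ → k ≤ p.eval (P.size i)

/-- A polynomial-time reduction from the enumeration problem `Q` to the enumeration problem
`P`: a polynomial-time map `f` on instances, and a polynomial-time map `g` which translates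
each item of an answer to `f i` into an item for `i` or rejects it.  The items that are not
rejected yield every member of an answer to `i` exactly once, and only polynomially many
items are rejected. -/
def PolyReduction (Q P : EnumProblem) : Prop :=
  ∃ (f : Q.Inst → P.Inst) (g : (i : Q.Inst) → P.Item (f i) → Option (Q.Item i))
    (cf cg : Cmd) (p : Polynomial ℕ),
    (∀ i : Q.Inst, P.size (f i) ≤ p.eval (Q.size i)) ∧
    (∀ i : Q.Inst, ∃ (t : Trace) (s : Store), Exec cf (initStore (Q.code i)) t s ∧
      s 0 = P.code (f i) ∧ t.length ≤ p.eval (Q.size i)) ∧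
    (∀ (i : Q.Inst) (x : P.Item (f i)), ∃ (t : Trace) (s : Store),
      Exec cg (initStore (Data.cons (Q.code i) (P.itemCode (f i) x))) t s ∧
      s 0 = Data.ofOption ((g i x).map (Q.itemCode i)) ∧ t.length ≤ p.eval (Q.size i)) ∧
    (∀ (i : Q.Inst) (S : Set (P.Item (f i))), P.IsAnswer (f i) S →
      Q.IsAnswer i {y | ∃ x ∈ S, g i x = some y} ∧
      (∀ x ∈ S, ∀ x' ∈ S, ∀ y, g i x = some y → g i x' = some y → x = x') ∧
      {x ∈ S | g i x = none}.encard ≤ (p.eval (Q.size i) : ℕ))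

/-- `P` is at least as hard as `Q`: there is a polynomial-time reduction from `Q` to `P`, and
output-polynomial, incremental-polynomial and polynomial-delay algorithms for `P` yield
algorithms of the same kind for `Q`. -/
def AtLeastAsHard (P Q : EnumProblem) : Prop :=
  PolyReduction Q P ∧
  (P.OutputPoly → Q.OutputPoly) ∧
  (P.IncrementalPoly → Q.IncrementalPoly) ∧
  (P.PolyDelay → Q.PolyDelay)

end EnumProblem

/-! ### Hypergraphs -/

/-- The inclusion-wise maximal independent sets of the hypergraph with edges `E`. -/
def MIS {α : Type*} (E : Set (Finset α)) : Set (Finset α) :=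
  {I | Maximal (fun I : Finset α => ∀ e ∈ E, ¬ e ⊆ I) I}

/-- The inclusion-wise minimal hitting sets of the hypergraph with edges `E`. -/
def MHS {α : Type*} (E : Set (Finset α)) : Set (Finset α) :=
  {T | Minimal (fun T : Finset α => ∀ e ∈ E, ∃ v ∈ T, v ∈ e) T}

/-- Hypergraphs on `Fin n`, with their edges listed in any order. -/
structure HypergraphInst where
  n : ℕ
  edges : List (Finset (Fin n))
  nodup : edges.Nodup

/-- A family of subsets of `Fin n` as a tree. -/
def familyCode (n : ℕ) (F : List (Finset (Fin n))) : Data :=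
  Data.cons (Data.ofNat n) (Data.ofList (F.map Data.ofFinset))

/-- Enumerate the maximal independent sets of a hypergraph. -/
def MISEnum : EnumProblem where
  Inst := HypergraphInst
  size H := H.n + H.edges.length
  code H := familyCode H.n H.edges
  Item H := Finset (Fin H.n)
  itemCode _ I := Data.ofFinset I
  IsAnswer H S := S = MIS {e | e ∈ H.edges}

/-- Enumerate the minimal hitting sets of a hypergraph. -/
def MHSEnum : EnumProblem where
  Inst := HypergraphInst
  size H := H.n + H.edges.length
  code H := familyCode H.n H.edges
  Item H := Finset (Fin H.n)
  itemCode _ T := Data.ofFinset T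
  IsAnswer H S := S = MHS {e | e ∈ H.edges}

/-! ### Closure systems -/

section Closure

variable {α : Type*} [Fintype α] [DecidableEq α]

def IsClosureSystem (C : Set (Finset α)) : Prop :=
  Finset.univ ∈ C ∧ ∀ A ∈ C, ∀ B ∈ C, A ∩ B ∈ C

/-- Convex geometries. -/
def IsConvexGeometry (C : Set (Finset α)) : Prop :=
  IsClosureSystem C ∧ ∅ ∈ C ∧ ∀ A ∈ C, A ≠ Finset.univ → ∃ x, x ∉ A ∧ insert x A ∈ C

/-- The irreducible closed sets of a closure system. -/
def irr (C : Set (Finset α)) : Set (Finset α) :=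
  {M | M ∈ C ∧ M ≠ Finset.univ ∧ ∀ A ∈ C, ∀ B ∈ C, M = A ∩ B → A = M ∨ B = M}

/-- The irreducible closed sets attached to `x`: the inclusion-wise maximal closed sets that
do not contain `x`. -/
def irrAt (C : Set (Finset α)) (x : α) : Set (Finset α) :=
  {M | Maximal (fun M : Finset α => M ∈ C ∧ x ∉ M) M}

end Closure

/-! ### Implicational bases -/

/-- An implication `prem → concl`. -/
structure Implication (α : Type*) where
  prem : Finset α
  concl : Finset α

section Bases

variable {α : Type*}

/-- The closed sets of the implicational base `B`. -/
def closedSets (B : Set (Implication α)) : Set (Finset α) :=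
  {C | ∀ i ∈ B, i.prem ⊆ C → i.concl ⊆ C}

/-- The arcs of the implication graph of `B`. -/
def Arc (B : Set (Implication α)) (a b : α) : Prop :=
  ∃ i ∈ B, a ∈ i.prem ∧ b ∈ i.concl

/-- The implication graph of `B` has no directed cycle. -/
def IsAcyclicBase (B : Set (Implication α)) : Prop :=
  ∀ a, ¬ Relation.TransGen (Arc B) a a

/-- The longest directed paths of the implication graph of `B` have exactly `h` vertices. For
acyclic `B` this is the number of elements of a longest chain of the induced poset. -/
def HasHeight (B : Set (Implication α)) (h : ℕ) : Prop :=
  (∃ l : List α, l.IsChain (Arc B) ∧ l.length = h) ∧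
    ∀ l : List α, l.IsChain (Arc B) → l.length ≤ h

/-- All conclusions are singletons. -/
def IsUnit (B : Set (Implication α)) : Prop :=
  ∀ i ∈ B, ∃ b, i.concl = {b}

/-- `B` is a unit-minimum implicational base of the closure system `C`. -/
def IsUnitMinimumBase (B : Set (Implication α)) (C : Set (Finset α)) : Prop :=
  IsUnit B ∧ closedSets B = C ∧
    ∀ B' : Set (Implication α), IsUnit B' → closedSets B' = C → B.encard ≤ B'.encard

end Bases

/-- `B` is an acyclic implicational base of height `2` of a convex geometry. (For acyclic `B`,
the closed sets form a convex geometry as soon as the empty set is closed.) -/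
def IsHeightTwoBase {n : ℕ} (B : Set (Implication (Fin n))) : Prop :=
  IsConvexGeometry (closedSets B) ∧ IsAcyclicBase B ∧ HasHeight B 2

/-- `C` is an acyclic convex geometry that admits an acyclic implicational base of
height `2`. -/
def AdmitsHeightTwoBase {n : ℕ} (C : Set (Finset (Fin n))) : Prop :=
  ∃ B : Set (Implication (Fin n)), IsHeightTwoBase B ∧ closedSets B = C

/-! ### The translation problems -/

def implicationCode {n : ℕ} (i : Implication (Fin n)) : Data :=
  Data.cons (Data.ofFinset i.prem) (Data.ofFinset i.concl)

/-- A class of implicational bases. -/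
abbrev BaseClass : Type := (n : ℕ) → Set (Implication (Fin n)) → Prop

/-- A class of closure systems. -/
abbrev SystemClass : Type := (n : ℕ) → Set (Finset (Fin n)) → Prop

/-- Implicational bases of the class `K`, with the implications listed in any order. -/
structure BaseInst (K : BaseClass) where
  n : ℕ
  imps : List (Implication (Fin n))
  nodup : imps.Nodup
  mem : K n {i | i ∈ imps}

def BaseInst.size {K : BaseClass} (B : BaseInst K) : ℕ := B.n + B.imps.length

def BaseInst.code {K : BaseClass} (B : BaseInst K) : Data :=
  Data.cons (Data.ofNat B.n) (Data.ofList (B.imps.map implicationCode))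

def BaseInst.system {K : BaseClass} (B : BaseInst K) : Set (Finset (Fin B.n)) :=
  closedSets {i | i ∈ B.imps}

/-- Enumerate the irreducible closed sets of an implicational base of the class `K`. -/
def ICSEnum (K : BaseClass) : EnumProblem where
  Inst := BaseInst K
  size B := B.size
  code B := B.code
  Item B := Finset (Fin B.n)
  itemCode _ M := Data.ofFinset M
  IsAnswer B S := S = irr B.system

/-- Enumerate the irreducible closed sets attached to a given element, for implicational bases
of the class `K`. -/
def ACSEnum (K : BaseClass) : EnumProblem where
  Inst := Σ B : BaseInst K, Fin B.n
  size Bx := Bx.1.size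
  code Bx := Data.cons Bx.1.code (Data.ofNat Bx.2)
  Item Bx := Finset (Fin Bx.1.n)
  itemCode _ M := Data.ofFinset M
  IsAnswer Bx S := S = irrAt Bx.1.system Bx.2

/-- Closure systems of the class `K`, given by the list of their irreducible closed sets in
any order. -/
structure IrrInst (K : SystemClass) where
  n : ℕ
  irrs : List (Finset (Fin n))
  nodup : irrs.Nodup
  system : Set (Finset (Fin n))
  isClosureSystem : IsClosureSystem system
  irr_eq : irr system = {M | M ∈ irrs}
  mem : K n system

/-- Given the irreducible closed sets of a closure system of the class `K`, generate a
unit-minimum implicational base. (Only the ground set and `irrs` are given to the program;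
`system` is determined by them.) -/
def MIBGen (K : SystemClass) : EnumProblem where
  Inst := IrrInst K
  size C := C.n + C.irrs.length
  code C := familyCode C.n C.irrs
  Item C := Implication (Fin C.n)
  itemCode _ i := implicationCode i
  IsAnswer C S := IsUnitMinimumBase S C.system

/-- The implicational base `{E → z : E an edge}` on `V ∪ {z}`, where the ground set is
`Option V` and `z` is `none`. -/
def gadgetBase {V : Type*} (E : Set (Finset V)) : Set (Implication (Option V)) :=
  (fun e => ⟨e.map Function.Embedding.some, {none}⟩) '' E

end EnumHardness

/-! The combinatorial core is the base `{e → z : e ∈ F}` whose premises avoid `z`. A set is closed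
iff it contains `z` or includes no member of `F`, so the maximal closed sets without `z` are the
maximal `F`-independent sets, and every other irreducible set is the complement of one element
different from `z` (`irr_starBase`). Listing all irreducible sets therefore lists the independent
sets together with linearly many known extra ones.

For this base to have height 2 and a convex geometry as closure system, `F` must be nonempty and
must not contain `∅`. Arbitrary hypergraphs are brought into this form by `extEdges`: vertex `0`
plays the role of `z`, vertex `1` joins every edge, and `{2}` becomes an edge. This creates at most
one new maximal independent set and at most one new minimal hitting set, both recognizable by vertex
`1`.

For the generation of bases, `F` consists of the minimal hitting sets of the extended hypergraph. By
hypergraph duality the irreducible sets of this system attached to `z` are complements of sets `e ∪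
{z}` with `e` a minimal edge (`irrAt_hittingSystem`), so the input can be computed in polynomial
time although `F` may be exponentially large. As `F` is an antichain, `{e → z : e ∈ F}` is the only
unit-minimum base (`eq_starBase_of_isUnitMinimumBase`), and any correct answer reveals `F`.
Complementation exchanges maximal independent sets and minimal hitting sets, so one source problem
per target suffices (`PolyReduction.compl`).

The rest concerns programs. `Polytime` is closed under composition, branching and size-controlled
iteration, which makes the reductions effective. A reduction carries algorithms over
(`PolyReduction.exists_program`): the given program is simulated on the reduced instance with its
registers shifted, and each output is passed through the decoder. Every output costs polynomially
more and polynomially many outputs are lost, so total time, incremental time and delay all stay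
polynomial. -/

namespace EnumHardness

/-! ### Polynomial bounds -/

/-- `T` is bounded by a polynomial in the size parameter `s`. -/
def PolyBounded {ι : Type*} (s T : ι → ℕ) : Prop :=
  ∃ p : Polynomial ℕ, ∀ i, T i ≤ p.eval (s i)

theorem eval_mono (p : Polynomial ℕ) {m n : ℕ} (h : m ≤ n) : p.eval m ≤ p.eval n := by
  rw [Polynomial.eval_eq_sum, Polynomial.eval_eq_sum]
  exact Finset.sum_le_sum fun i _ => Nat.mul_le_mul_left _ (Nat.pow_le_pow_left h i)

namespace PolyBounded

variable {ι : Type*} {s T U : ι → ℕ}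

theorem self (s : ι → ℕ) : PolyBounded s s := ⟨Polynomial.X, fun i => by simp⟩

theorem const (s : ι → ℕ) (c : ℕ) : PolyBounded s fun _ => c :=
  ⟨Polynomial.C c, fun i => by simp⟩

theorem mono (h : PolyBounded s U) (hT : ∀ i, T i ≤ U i) : PolyBounded s T :=
  h.imp fun _ hp i => (hT i).trans (hp i)

theorem add (hT : PolyBounded s T) (hU : PolyBounded s U) :
    PolyBounded s fun i => T i + U i := by
  obtain ⟨p, hp⟩ := hT
  obtain ⟨q, hq⟩ := hU
  exact ⟨p + q, fun i => by simpa using Nat.add_le_add (hp i) (hq i)⟩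

theorem mul (hT : PolyBounded s T) (hU : PolyBounded s U) :
    PolyBounded s fun i => T i * U i := by
  obtain ⟨p, hp⟩ := hT
  obtain ⟨q, hq⟩ := hU
  exact ⟨p * q, fun i => by simpa using Nat.mul_le_mul (hp i) (hq i)⟩

theorem eval (hT : PolyBounded s T) (p : Polynomial ℕ) :
    PolyBounded s fun i => p.eval (T i) := by
  obtain ⟨q, hq⟩ := hT
  exact ⟨p.comp q, fun i => by simpa using eval_mono p (hq i)⟩

end PolyBounded

/-! ### Trees as lists -/

namespace Data

/-- Nodes of the tree without sharing. This is only the parameter of the time bounds: a command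
costs one step whatever the trees involved. -/
def size : Data → ℕ
  | nil => 1
  | cons a b => 1 + a.size + b.size

/-- Reading along the right spine makes every tree a list. List operations on `Data` thus need no
well-formedness condition. -/
def toList : Data → List Data
  | nil => []
  | cons a b => a :: b.toList

/-- Branching on whether the first argument is different from `nil`. -/
def cond : Data → Data → Data → Data
  | nil, _, y => y
  | cons _ _, x, _ => x

@[simp] theorem hd_nil : hd nil = nil := rfl
@[simp] theorem tl_nil : tl nil = nil := rfl
@[simp] theorem hd_cons (a b : Data) : hd (cons a b) = a := rfl
@[simp] theorem tl_cons (a b : Data) : tl (cons a b) = b := rfl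
@[simp] theorem size_nil : size nil = 1 := rfl
@[simp] theorem size_cons (a b : Data) : size (cons a b) = 1 + a.size + b.size := rfl
@[simp] theorem toList_nil : toList nil = [] := rfl
@[simp] theorem toList_cons (a b : Data) : toList (cons a b) = a :: b.toList := rfl
@[simp] theorem cond_nil (x y : Data) : cond nil x y = y := rfl
@[simp] theorem cond_cons (a b x y : Data) : cond (cons a b) x y = x := rfl
@[simp] theorem ofList_nil : ofList [] = nil := rfl
@[simp] theorem ofList_cons (a : Data) (l : List Data) : ofList (a :: l) = cons a (ofList l) := rfl

@[simp] theorem cond_ofBool (b : Bool) (x y : Data) : cond (ofBool b) x y = if b then x else y := by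
  cases b <;> rfl

@[simp] theorem toList_ofList (l : List Data) : toList (ofList l) = l := by
  induction l with
  | nil => rfl
  | cons a l ih => simp [ih]

@[simp] theorem ofList_toList (d : Data) : ofList (toList d) = d := by
  induction d with
  | nil => rfl
  | cons a b _ ih => simp [ih]

theorem size_hd_le (d : Data) : d.hd.size ≤ d.size := by
  cases d with
  | nil => exact le_rfl
  | cons a b => simp; omega

theorem size_tl_le (d : Data) : d.tl.size ≤ d.size := by
  cases d <;> simp

theorem size_le_of_mem {x d : Data} (h : x ∈ toList d) : x.size ≤ d.size := by
  induction d with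
  | nil => simp at h
  | cons a b _ ih =>
    rcases List.mem_cons.1 h with rfl | h
    · simp; omega
    · have := ih h
      simp; omega

theorem length_toList_le (d : Data) : d.toList.length ≤ d.size := by
  induction d with
  | nil => simp
  | cons a b _ ih => simp; omega

theorem size_ofBool_le (b : Bool) : (ofBool b).size ≤ 3 := by
  cases b <;> simp [ofBool]

theorem size_ofList_le {l : List Data} {B : ℕ} (h : ∀ x ∈ l, x.size ≤ B) :
    (ofList l).size ≤ l.length * (B + 1) + 1 := by
  induction l with
  | nil => simp
  | cons a l ih =>
    have h1 := ih fun x hx => h x (List.mem_cons_of_mem _ hx)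
    have h2 := h a List.mem_cons_self
    simp only [ofList_cons, size_cons, List.length_cons, add_mul, one_mul]
    omega

end Data

/-! ### Silent runs and subroutines -/

/-- `c` runs from `σ` to `σ'` in `a` steps, without output. -/
def Run (c : Cmd) (σ : Store) (a : ℕ) (σ' : Store) : Prop :=
  Exec c σ (List.replicate a none) σ'

namespace Run

theorem skip (σ : Store) : Run .skip σ 1 σ := Exec.skip σ

theorem assign (σ : Store) (r : ℕ) (e : Expr) :
    Run (.assign r e) σ 1 (Function.update σ r (e.eval σ)) := Exec.assign σ r e

theorem seq {c d : Cmd} {σ σ' σ'' : Store} {a b : ℕ} (h : Run c σ a σ') (h' : Run d σ' b σ'') :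
    Run (.seq c d) σ (a + b) σ'' := by
  unfold Run
  rw [List.replicate_add]
  exact Exec.seq h h'

theorem iteTrue {e : Expr} {c d : Cmd} {σ σ' : Store} {a : ℕ} (he : e.eval σ ≠ Data.nil)
    (h : Run c σ a σ') : Run (.ite e c d) σ (a + 1) σ' :=
  Exec.iteTrue he h

theorem iteFalse {e : Expr} {c d : Cmd} {σ σ' : Store} {a : ℕ} (he : e.eval σ = Data.nil)
    (h : Run d σ a σ') : Run (.ite e c d) σ (a + 1) σ' :=
  Exec.iteFalse he h

theorem loopFalse {e : Expr} {c : Cmd} {σ : Store} (he : e.eval σ = Data.nil) :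
    Run (.loop e c) σ 1 σ :=
  Exec.loopFalse he

theorem loopTrue {e : Expr} {c : Cmd} {σ σ' σ'' : Store} {a b : ℕ} (he : e.eval σ ≠ Data.nil)
    (h : Run c σ a σ') (h' : Run (.loop e c) σ' b σ'') : Run (.loop e c) σ (a + b + 1) σ'' := by
  unfold Run
  rw [List.replicate_succ, List.replicate_add]
  exact Exec.loopTrue he h h'

end Run

/-- As a subroutine, `c` turns the value `d` of register `0` into `v` within `B` steps, without
output and without changing any register from `k` on. -/
def Call (c : Cmd) (k : ℕ) (d v : Data) (B : ℕ) : Prop :=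
  ∀ σ : Store, σ 0 = d → ∃ (a : ℕ) (σ' : Store), Run c σ a σ' ∧ σ' 0 = v ∧
    (∀ r, k ≤ r → σ' r = σ r) ∧ a ≤ B

theorem Call.mono {c : Cmd} {k k' : ℕ} {d v : Data} {B B' : ℕ} (h : Call c k d v B)
    (hk : k ≤ k') (hB : B ≤ B') : Call c k' d v B' := fun σ hσ => by
  obtain ⟨a, σ', h1, h2, h3, h4⟩ := h σ hσ
  exact ⟨a, σ', h1, h2, fun r hr => h3 r (hk.trans hr), h4.trans hB⟩

/-! ### Polynomial-time functions on trees -/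

/-- `f` is computed in polynomial time, with values of polynomial size. -/
def Polytime (f : Data → Data) : Prop :=
  ∃ (c : Cmd) (k : ℕ) (T : Data → ℕ), 0 < k ∧ PolyBounded Data.size T ∧
    PolyBounded Data.size (fun d => (f d).size) ∧ ∀ d, Call c k d (f d) (T d)

theorem PolyBounded.comp_polytime {f : Data → Data} {T : Data → ℕ}
    (hf : PolyBounded Data.size fun d => (f d).size)
    (hT : PolyBounded Data.size T) : PolyBounded Data.size fun d => T (f d) := by
  obtain ⟨q, hq⟩ := hT
  exact (hf.eval q).mono fun d => hq (f d)

namespace Polytime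

variable {f g h : Data → Data}

theorem size_bounded (hf : Polytime f) : PolyBounded Data.size fun d => (f d).size :=
  hf.choose_spec.choose_spec.choose_spec.2.2.1

theorem of_expr (e : Expr) (he : ∀ σ : Store, e.eval σ = f (σ 0))
    (hs : PolyBounded Data.size fun d => (f d).size) : Polytime f := by
  refine ⟨.assign 0 e, 1, fun _ => 1, one_pos, .const _ _, hs, fun d σ hσ => ?_⟩
  refine ⟨1, _, Run.assign _ _ _, by simp [he, hσ], fun r hr => ?_, le_rfl⟩
  exact Function.update_of_ne (by omega) _ _

protected theorem id : Polytime fun d => d :=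
  of_expr (.var 0) (fun _ => rfl) (.self _)

protected theorem nil : Polytime fun _ => Data.nil :=
  of_expr .nil (fun _ => rfl) (.const _ _)

/-- The size bound contained in `Polytime` is what makes the time of `f` at `g d` polynomial in the
size of `d`. -/
theorem comp (hf : Polytime f) (hg : Polytime g) : Polytime fun d => f (g d) := by
  have hs := hg.size_bounded
  obtain ⟨cf, kf, Tf, hk, hTf, hsf, hf⟩ := hf
  obtain ⟨cg, kg, Tg, _, hTg, hsg, hg⟩ := hg
  refine ⟨.seq cg cf, max kf kg, fun d => Tg d + Tf (g d), by omega,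
    hTg.add (hs.comp_polytime hTf), hs.comp_polytime hsf, fun d σ hσ => ?_⟩
  obtain ⟨a, σ', r1, v1, p1, b1⟩ := hg d σ hσ
  obtain ⟨b, σ'', r2, v2, p2, b2⟩ := hf _ σ' v1
  refine ⟨a + b, σ'', r1.seq r2, v2, fun r hr => ?_, by dsimp only; omega⟩
  rw [p2 r (by omega), p1 r (by omega)]

theorem hd (hf : Polytime f) : Polytime fun d => (f d).hd :=
  comp (f := Data.hd) (of_expr (.hd (.var 0)) (fun _ => rfl)
    ((PolyBounded.self _).mono Data.size_hd_le)) hf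

theorem tl (hf : Polytime f) : Polytime fun d => (f d).tl :=
  comp (f := Data.tl) (of_expr (.tl (.var 0)) (fun _ => rfl)
    ((PolyBounded.self _).mono Data.size_tl_le)) hf

theorem cons (hf : Polytime f) (hg : Polytime g) : Polytime fun d => Data.cons (f d) (g d) := by
  obtain ⟨cf, kf, Tf, hk, hTf, hsf, hf⟩ := hf
  obtain ⟨cg, kg, Tg, _, hTg, hsg, hg⟩ := hg
  set K := max kf kg with hK
  -- Register `K` saves the input and `K + 1` the first value; both lie beyond the registers that
  -- `cf` and `cg` may change.
  refine ⟨.seq (.assign K (.var 0)) (.seq cf (.seq (.assign (K + 1) (.var 0))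
    (.seq (.assign 0 (.var K)) (.seq cg (.assign 0 (.cons (.var (K + 1)) (.var 0))))))), K + 2,
    fun d => Tf d + Tg d + 4, by omega, (hTf.add hTg).add (.const _ _),
    ((PolyBounded.const _ 1).add hsf).add hsg, fun d σ hσ => ?_⟩
  have r0 := Run.assign σ K (.var 0)
  obtain ⟨a, σ₁, r1, v1, p1, b1⟩ := hf d (Function.update σ K (σ 0))
    (by rw [Function.update_of_ne (by omega), hσ])
  have r2 := (Run.assign σ₁ (K + 1) (.var 0))
  have r3 := (Run.assign (Function.update σ₁ (K + 1) (σ₁ 0)) 0 (.var K))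
  obtain ⟨b, σ₂, r4, v4, p4, b4⟩ := hg d (Function.update (Function.update σ₁ (K + 1) (σ₁ 0)) 0
    ((Expr.var K).eval (Function.update σ₁ (K + 1) (σ₁ 0)))) (by
      simp [Expr.eval, p1 K (by omega), hσ])
  have r5 := Run.assign σ₂ 0 (.cons (.var (K + 1)) (.var 0))
  refine ⟨_, _, r0.seq (r1.seq (r2.seq (r3.seq (r4.seq r5)))), ?_, fun r hr => ?_, by
    dsimp only; omega⟩
  · simp [Expr.eval, v4, p4 (K + 1) (by omega), v1]
  · rw [Function.update_of_ne (by omega), p4 r (by omega), Function.update_of_ne (by omega),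
      Function.update_of_ne (by omega), p1 r (by omega), Function.update_of_ne (by omega)]

theorem cond (hf : Polytime f) (hg : Polytime g) (hh : Polytime h) :
    Polytime fun d => Data.cond (f d) (g d) (h d) := by
  obtain ⟨cf, kf, Tf, hk, hTf, hsf, hf⟩ := hf
  obtain ⟨cg, kg, Tg, _, hTg, hsg, hg⟩ := hg
  obtain ⟨ch, kh, Th, _, hTh, hsh, hh⟩ := hh
  set K := max kf (max kg kh) with hK
  refine ⟨.seq (.assign K (.var 0)) (.seq cf (.ite (.var 0) (.seq (.assign 0 (.var K)) cg)
    (.seq (.assign 0 (.var K)) ch))), K + 1, fun d => Tf d + (Tg d + Th d) + 3, by omega,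
    (hTf.add (hTg.add hTh)).add (.const _ _), (hsg.add hsh).mono fun d => ?_, fun d σ hσ => ?_⟩
  · dsimp only
    cases f d <;> simp
  have r0 := Run.assign σ K (.var 0)
  obtain ⟨a, σ₁, r1, v1, p1, b1⟩ := hf d (Function.update σ K (σ 0))
    (by rw [Function.update_of_ne (by omega), hσ])
  have r2 := Run.assign σ₁ 0 (.var K)
  have hd : (Function.update σ₁ 0 ((Expr.var K).eval σ₁)) 0 = d := by
    simp [Expr.eval, p1 K (by omega), hσ]
  have aux : ∀ σ₂ : Store, (∀ r, K ≤ r → σ₂ r =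
      (Function.update σ₁ 0 ((Expr.var K).eval σ₁)) r) → ∀ r, K + 1 ≤ r → σ₂ r = σ r := by
    intro σ₂ h₂ r hr
    rw [h₂ r (by omega), Function.update_of_ne (by omega), p1 r (by omega),
      Function.update_of_ne (by omega)]
  cases hfd : f d with
  | nil =>
    obtain ⟨b, σ₂, r3, v3, p3, b3⟩ := hh d _ hd
    refine ⟨_, σ₂, r0.seq (r1.seq (Run.iteFalse (by simp [Expr.eval, v1, hfd]) (r2.seq r3))),
      by simp [v3, hfd], aux σ₂ fun r hr => p3 r (by omega), by dsimp only; omega⟩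
  | cons x y =>
    obtain ⟨b, σ₂, r3, v3, p3, b3⟩ := hg d _ hd
    refine ⟨_, σ₂, r0.seq (r1.seq (Run.iteTrue (by simp [Expr.eval, v1, hfd]) (r2.seq r3))),
      by simp [v3, hfd], aux σ₂ fun r hr => p3 r (by omega), by dsimp only; omega⟩

end Polytime

/-- Iterate `f` along a list, with the accumulator, the list element and `env` as arguments. -/
def foldData (f : Data → Data) (env : Data) (l : List Data) (a : Data) : Data :=
  l.foldl (fun acc x => f (.cons acc (.cons x env))) a

@[simp] theorem foldData_nil (f : Data → Data) (env a : Data) : foldData f env [] a = a := rfl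

@[simp] theorem foldData_cons (f : Data → Data) (env x a : Data) (l : List Data) :
    foldData f env (x :: l) a = foldData f env l (f (.cons a (.cons x env))) := rfl

/-- Loop invariant: register `0` holds the accumulator, `K` the environment, `K + 1` the rest of the
list. The bound `B` is asked only at accumulators that actually occur. A round costs the test, two
assignments and the call, and one last test ends the loop. -/
theorem run_fold {c : Cmd} {K : ℕ} {f : Data → Data} {T : Data → ℕ} (hK : 0 < K)
    (hc : ∀ d, Call c K d (f d) (T d)) (env : Data) (B : ℕ) (l : List Data) :
    ∀ σ : Store, σ K = env → σ (K + 1) = Data.ofList l →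
      (∀ l₁ x l₂, l = l₁ ++ x :: l₂ → T (.cons (foldData f env l₁ (σ 0)) (.cons x env)) ≤ B) →
      ∃ (a : ℕ) (σ' : Store), Run (.loop (.var (K + 1))
          (.seq (.assign 0 (.cons (.var 0) (.cons (.hd (.var (K + 1))) (.var K))))
            (.seq c (.assign (K + 1) (.tl (.var (K + 1))))))) σ a σ' ∧
        σ' 0 = foldData f env l (σ 0) ∧ (∀ r, K + 2 ≤ r → σ' r = σ r) ∧
        a ≤ l.length * (B + 3) + 1 := by
  induction l with
  | nil =>
    intro σ _ h2 _
    exact ⟨1, σ, Run.loopFalse (by simpa [Expr.eval] using h2), rfl, fun _ _ => rfl, by simp⟩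
  | cons x l ih =>
    intro σ h1 h2 hB
    have r0 := Run.assign σ 0 (.cons (.var 0) (.cons (.hd (.var (K + 1))) (.var K)))
    obtain ⟨a, σ₁, r1, v1, p1, b1⟩ := hc (.cons (σ 0) (.cons x env))
      (Function.update σ 0 ((Expr.cons (.var 0) (.cons (.hd (.var (K + 1))) (.var K))).eval σ)) (by
        simp [Expr.eval, h1, h2])
    have r2 := Run.assign σ₁ (K + 1) (.tl (.var (K + 1)))
    have e0 : (Function.update σ₁ (K + 1) ((Expr.tl (.var (K + 1))).eval σ₁)) 0 =
        f (.cons (σ 0) (.cons x env)) := by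
      rw [Function.update_of_ne (by omega), v1]
    obtain ⟨b, σ₂, r3, v3, p3, b3⟩ := ih
      (Function.update σ₁ (K + 1) ((Expr.tl (.var (K + 1))).eval σ₁))
      (by rw [Function.update_of_ne (by omega), p1 K le_rfl, Function.update_of_ne (by omega), h1])
      (by rw [Function.update_self, Expr.eval, Expr.eval, p1 _ (by omega),
            Function.update_of_ne (by omega), h2]; rfl)
      (by
        intro l₁ y l₂ hl
        rw [e0]
        exact hB (x :: l₁) y l₂ (by simp [hl]))
    refine ⟨_, σ₂, Run.loopTrue (by simp [Expr.eval, h2]) (r0.seq (r1.seq r2)) r3, ?_, ?_, ?_⟩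
    · rw [v3, e0]; rfl
    · intro r hr
      rw [p3 r hr, Function.update_of_ne (by omega), p1 r (by omega),
        Function.update_of_ne (by omega)]
    · have := hB [] x l rfl
      simp only [foldData_nil] at this
      simp only [List.length_cons, add_mul, one_mul]
      omega

namespace Polytime

variable {f g h : Data → Data}

/-- A polynomial-time step is not enough: iterating `acc ↦ cons acc acc` gives exponential size.
Bounding the accumulator after every prefix of the list yields one polynomial for the cost of all
steps. -/
theorem fold (hf : Polytime f) (hg : Polytime g) (hh : Polytime h) {q : Data → ℕ}
    (hq : PolyBounded Data.size q)
    (hb : ∀ d l₁ l₂, (g d).toList = l₁ ++ l₂ → (foldData f d l₁ (h d)).size ≤ q d) :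
    Polytime fun d => foldData f d (g d).toList (h d) := by
  have hgs := hg.size_bounded
  obtain ⟨c₀, k₀, T₀, hk₀, hT₀, -, h₀⟩ := hg.cons hh
  obtain ⟨cf, kf, Tf, hk, ⟨p, hp⟩, hsf, hf⟩ := hf
  set K := max k₀ kf with hK
  have hbd : PolyBounded Data.size fun d =>
      p.eval (1 + q d + (1 + (g d).size + d.size)) :=
    (((PolyBounded.const _ 1).add hq).add
      (((PolyBounded.const _ 1).add hgs).add (.self _))).eval p
  refine ⟨.seq (.assign K (.var 0)) (.seq c₀ (.seq (.assign (K + 1) (.hd (.var 0)))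
    (.seq (.assign 0 (.tl (.var 0))) (.loop (.var (K + 1))
      (.seq (.assign 0 (.cons (.var 0) (.cons (.hd (.var (K + 1))) (.var K))))
        (.seq cf (.assign (K + 1) (.tl (.var (K + 1)))))))))), K + 2,
    fun d => T₀ d + ((g d).size * (p.eval (1 + q d + (1 + (g d).size + d.size)) + 3) + 4),
    by omega, hT₀.add ((hgs.mul (hbd.add (.const _ 3))).add (.const _ 4)),
    hq.mono fun d => hb d _ [] (by simp), fun d σ hσ => ?_⟩
  have r0 := Run.assign σ K (.var 0)
  obtain ⟨a, σ₁, r1, v1, p1, b1⟩ := h₀ d (Function.update σ K (σ 0))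
    (by rw [Function.update_of_ne (by omega), hσ])
  have r2 := Run.assign σ₁ (K + 1) (.hd (.var 0))
  obtain ⟨σ₂, hσ₂⟩ : ∃ σ₂, σ₂ = Function.update σ₁ (K + 1) ((Expr.hd (.var 0)).eval σ₁) := ⟨_, rfl⟩
  rw [← hσ₂] at r2
  have r3 := Run.assign σ₂ 0 (.tl (.var 0))
  have e0 : (Function.update σ₂ 0 ((Expr.tl (.var 0)).eval σ₂)) 0 = h d := by
    simp [Expr.eval, hσ₂, v1]
  obtain ⟨b, σ₃, r4, v4, p4, b4⟩ := run_fold (c := cf) (K := K) (f := f) (T := Tf) (by omega)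
    (fun d => (hf d).mono (by omega) le_rfl) d (p.eval (1 + q d + (1 + (g d).size + d.size)))
    (g d).toList (Function.update σ₂ 0 ((Expr.tl (.var 0)).eval σ₂))
    (by rw [Function.update_of_ne (by omega), hσ₂, Function.update_of_ne (by omega), p1 K (by omega),
          Function.update_self, hσ])
    (by rw [Function.update_of_ne (by omega), hσ₂, Function.update_self]
        simp [Expr.eval, v1])
    (by
      intro l₁ x l₂ hl
      rw [e0]
      refine (hp _).trans (eval_mono p ?_)
      have h1 := hb d l₁ _ hl
      have h2 : x.size ≤ (g d).size := Data.size_le_of_mem (by rw [hl]; simp)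
      simp only [Data.size_cons]
      omega)
  refine ⟨_, σ₃, r0.seq (r1.seq (r2.seq (r3.seq r4))), by rw [v4, e0], fun r hr => ?_, ?_⟩
  · rw [p4 r hr, Function.update_of_ne (by omega), hσ₂, Function.update_of_ne (by omega),
      p1 r (by omega), Function.update_of_ne (by omega)]
  · have := Nat.mul_le_mul_right (p.eval (1 + q d + (1 + (g d).size + d.size)) + 3)
      (Data.length_toList_le (g d))
    dsimp only
    omega

/-- Iteration is polynomial if each step enlarges the accumulator by a polynomial amount that
does not depend on the accumulator. -/
theorem fold_of_add (hf : Polytime f) (hg : Polytime g) (hh : Polytime h) {w : Data → ℕ}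
    (hw : PolyBounded Data.size w)
    (hb : ∀ a x d, (f (.cons a (.cons x d))).size ≤ a.size + w (.cons x d)) :
    Polytime fun d => foldData f d (g d).toList (h d) := by
  obtain ⟨p, hp⟩ := hw
  have key : ∀ d B l a, (∀ x ∈ l, x.size ≤ B) →
      (foldData f d l a).size ≤ a.size + l.length * p.eval (1 + B + d.size) := by
    intro d B l
    induction l with
    | nil => simp
    | cons x l ih =>
      intro a hx
      have h1 := ih (f (.cons a (.cons x d))) fun y hy => hx y (List.mem_cons_of_mem _ hy)
      have h2 := hb a x d
      have h3 := (hp (.cons x d)).trans (eval_mono p (n := 1 + B + d.size) (by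
        have := hx x List.mem_cons_self
        simp only [Data.size_cons]; omega))
      simp only [foldData_cons, List.length_cons, add_mul, one_mul]
      omega
  refine fold hf hg hh (q := fun d => (h d).size + (g d).size * p.eval (1 + (g d).size + d.size))
    (hh.size_bounded.add (hg.size_bounded.mul ((((PolyBounded.const _ 1).add
      hg.size_bounded).add (.self _)).eval p))) fun d l₁ l₂ hl => ?_
  refine (key d (g d).size l₁ (h d) fun x hx => Data.size_le_of_mem (by rw [hl]; simp [hx])).trans
    (Nat.add_le_add_left (Nat.mul_le_mul_right _ ?_) _)
  have := Data.length_toList_le (g d)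
  rw [hl, List.length_append] at this
  omega

end Polytime

/-! ### Arbitrary programs as subroutines -/

/-- A strict upper bound for the registers that occur in an expression. -/
def Expr.bound : Expr → ℕ
  | .var r => r + 1
  | .nil => 0
  | .cons a b => max a.bound b.bound
  | .hd a => a.bound
  | .tl a => a.bound

/-- A strict upper bound for the registers that occur in a program. -/
def Cmd.bound : Cmd → ℕ
  | .skip => 0
  | .assign r e => max (r + 1) e.bound
  | .emit e => e.bound
  | .seq c d => max c.bound d.bound
  | .ite e c d => max e.bound (max c.bound d.bound)
  | .loop e c => max e.bound c.bound

/-- The program without its outputs. -/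
def Cmd.silence : Cmd → Cmd
  | .skip => .skip
  | .assign r e => .assign r e
  | .emit _ => .skip
  | .seq c d => .seq c.silence d.silence
  | .ite e c d => .ite e c.silence d.silence
  | .loop e c => .loop e c.silence

theorem Expr.eval_congr {s σ : Store} {k : ℕ} (h : ∀ r, r < k → σ r = s r) (e : Expr)
    (he : e.bound ≤ k) : e.eval σ = e.eval s := by
  induction e with
  | var r => exact h r he
  | nil => rfl
  | cons a b iha ihb =>
    simp only [Expr.bound, max_le_iff] at he
    simp [Expr.eval, iha he.1, ihb he.2]
  | hd a ih => simp [Expr.eval, ih he]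
  | tl a ih => simp [Expr.eval, ih he]

/-- A run depends on the registers of the program only, and changes no other registers. -/
theorem Exec.silence {c : Cmd} {s s' : Store} {t : Trace} (H : Exec c s t s') {k : ℕ} :
    ∀ σ : Store, c.bound ≤ k → (∀ r, r < k → σ r = s r) →
      ∃ σ', Run c.silence σ t.length σ' ∧ (∀ r, r < k → σ' r = s' r) ∧
        ∀ r, k ≤ r → σ' r = σ r := by
  induction H with
  | skip s => exact fun σ _ h => ⟨σ, Run.skip σ, h, fun _ _ => rfl⟩
  | assign s r e =>
    intro σ hk h
    simp only [Cmd.bound, max_le_iff] at hk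
    refine ⟨_, Run.assign σ r e, fun r' hr' => ?_, fun r' hr' => ?_⟩
    · rw [Expr.eval_congr h e hk.2]
      by_cases hrr : r' = r
      · subst hrr; simp
      · simp [hrr, h r' hr']
    · exact Function.update_of_ne (by omega) _ _
  | emit s e => exact fun σ _ h => ⟨σ, Run.skip σ, h, fun _ _ => rfl⟩
  | seq _ _ ih₁ ih₂ =>
    intro σ hk h
    simp only [Cmd.bound, max_le_iff] at hk
    obtain ⟨σ₁, r1, a1, b1⟩ := ih₁ σ hk.1 h
    obtain ⟨σ₂, r2, a2, b2⟩ := ih₂ σ₁ hk.2 a1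
    exact ⟨σ₂, by simpa [Cmd.silence] using r1.seq r2, a2, fun r hr => (b2 r hr).trans (b1 r hr)⟩
  | iteTrue he _ ih =>
    intro σ hk h
    simp only [Cmd.bound, max_le_iff] at hk
    obtain ⟨σ₁, r1, a1, b1⟩ := ih σ hk.2.1 h
    exact ⟨σ₁, Run.iteTrue (by rwa [Expr.eval_congr h _ hk.1]) r1, a1, b1⟩
  | iteFalse he _ ih =>
    intro σ hk h
    simp only [Cmd.bound, max_le_iff] at hk
    obtain ⟨σ₁, r1, a1, b1⟩ := ih σ hk.2.2 h
    exact ⟨σ₁, Run.iteFalse (by rwa [Expr.eval_congr h _ hk.1]) r1, a1, b1⟩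
  | loopFalse he =>
    intro σ hk h
    simp only [Cmd.bound, max_le_iff] at hk
    exact ⟨σ, Run.loopFalse (by rwa [Expr.eval_congr h _ hk.1]), h, fun _ _ => rfl⟩
  | loopTrue he _ _ ih₁ ih₂ =>
    intro σ hk h
    simp only [Cmd.bound, max_le_iff] at hk
    obtain ⟨σ₁, r1, a1, b1⟩ := ih₁ σ hk.2 h
    obtain ⟨σ₂, r2, a2, b2⟩ := ih₂ σ₁ (by simp [Cmd.bound, hk]) a1
    exact ⟨σ₂, by simpa [Cmd.silence] using Run.loopTrue (by rwa [Expr.eval_congr h _ hk.1]) r1 r2, a2,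
      fun r hr => (b2 r hr).trans (b1 r hr)⟩

/-- Set the registers `1, …, k` to `nil`. -/
def Cmd.clear : ℕ → Cmd
  | 0 => .skip
  | k + 1 => .seq (clear k) (.assign (k + 1) .nil)

theorem run_clear (k : ℕ) (σ : Store) : Run (Cmd.clear k) σ (k + 1)
    fun r => if 0 < r ∧ r ≤ k then Data.nil else σ r := by
  induction k with
  | zero =>
    have h : (fun r => if 0 < r ∧ r ≤ 0 then Data.nil else σ r) = σ := by
      funext r
      exact if_neg (by omega)
    rw [h]
    exact Run.skip σ
  | succ k ih =>
    have := ih.seq (Run.assign _ (k + 1) .nil)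
    have e : (fun r => if 0 < r ∧ r ≤ k + 1 then Data.nil else σ r) = Function.update
        (fun r => if 0 < r ∧ r ≤ k then Data.nil else σ r) (k + 1) Data.nil := ?_
    · rw [e]
      exact this
    funext r
    by_cases hr : r = k + 1
    · subst hr; simp
    · rw [Function.update_of_ne hr]
      congr 1
      exact propext ⟨fun h => ⟨h.1, by omega⟩, fun h => ⟨h.1, by omega⟩⟩

/-- The program as a subroutine: it silently runs on the value of register `0` only. -/
def Cmd.subroutine (c : Cmd) : Cmd := .seq (Cmd.clear c.bound) c.silence

/-- The run of `c` is only known from a store that is `nil` outside register `0`, hence the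
clearing. Silencing replaces each output by one idle step, so the running time is unchanged. -/
theorem call_subroutine {c : Cmd} {d : Data} {t : Trace} {s : Store}
    (H : Exec c (initStore d) t s) :
    Call c.subroutine (c.bound + 1) d (s 0) (c.bound + 1 + t.length) := by
  intro σ hσ
  obtain ⟨σ', r1, a1, b1⟩ := H.silence (k := c.bound + 1)
    (fun r => if 0 < r ∧ r ≤ c.bound then Data.nil else σ r) (by omega) (by
      intro r hr
      rcases Nat.eq_zero_or_pos r with rfl | h0
      · simp [initStore, hσ]
      · rw [if_pos ⟨h0, by omega⟩, initStore, Function.update_of_ne (by omega)])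
  refine ⟨_, σ', (run_clear c.bound σ).seq r1, a1 0 (by omega), fun r hr => ?_, le_rfl⟩
  rw [b1 r hr, if_neg (by omega)]

/-! ### Translating the outputs of a program -/

/-- Renumber the registers. -/
def Expr.shift (m : ℕ) : Expr → Expr
  | .var r => .var (r + m)
  | .nil => .nil
  | .cons a b => .cons (a.shift m) (b.shift m)
  | .hd a => .hd (a.shift m)
  | .tl a => .tl (a.shift m)

theorem Expr.eval_shift {m : ℕ} {s σ : Store} (h : ∀ r, σ (r + m) = s r) (e : Expr) :
    (e.shift m).eval σ = e.eval s := by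
  induction e with
  | var r => exact h r
  | nil => rfl
  | cons a b iha ihb => simp [Expr.shift, Expr.eval, iha, ihb]
  | hd a ih => simp [Expr.shift, Expr.eval, ih]
  | tl a ih => simp [Expr.shift, Expr.eval, ih]

/-- Renumber the registers by `K + 1`, and translate the outputs with the subroutine `cg`, whose
second argument is the value of register `K`. -/
def Cmd.translate (c : Cmd) (cg : Cmd) (K : ℕ) : Cmd :=
  match c with
  | .skip => .skip
  | .assign r e => .assign (r + (K + 1)) (e.shift (K + 1))
  | .emit e => .seq (.assign 0 (.cons (.var K) (e.shift (K + 1)))) (.seq cg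
      (.ite (.var 0) (.emit (.tl (.var 0))) .skip))
  | .seq c d => .seq (c.translate cg K) (d.translate cg K)
  | .ite e c d => .ite (e.shift (K + 1)) (c.translate cg K) (d.translate cg K)
  | .loop e c => .loop (e.shift (K + 1)) (c.translate cg K)

/-- The trace `t'` results from the trace `t`, which outputs the items in the list `l`, if each
item `x` is replaced by `h x`, which takes at most `B + 1` steps. -/
inductive Translates {ι : Type} (code : ι → Data) (h : ι → Option Data) (B : ℕ) :
    Trace → List ι → Trace → Prop
  | nil : Translates code h B [] [] []
  | none {t : Trace} {l : List ι} {t' : Trace} :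
      Translates code h B t l t' → Translates code h B (none :: t) l (none :: t')
  | item {t : Trace} {l : List ι} {t' : Trace} (x : ι) (a : ℕ) :
      a ≤ B → Translates code h B t l t' →
      Translates code h B (some (code x) :: t) (x :: l)
        (List.replicate a none ++ ((h x).toList.map some ++ t'))

section Translates

variable {ι : Type} {code : ι → Data} {h : ι → Option Data} {B : ℕ}

theorem Translates.append {t₁ t₂ t₁' t₂' : Trace} {l₁ l₂ : List ι}
    (H₁ : Translates code h B t₁ l₁ t₁') (H₂ : Translates code h B t₂ l₂ t₂') :
    Translates code h B (t₁ ++ t₂) (l₁ ++ l₂) (t₁' ++ t₂') := by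
  induction H₁ with
  | nil => exact H₂
  | none _ ih => exact ih.none
  | item x a ha _ ih => simpa using ih.item x a ha

@[simp] theorem outputs_append (t t' : Trace) : outputs (t ++ t') = outputs t ++ outputs t' :=
  List.reduceOption_append _ _

@[simp] theorem outputs_none (t : Trace) : outputs (none :: t) = outputs t := rfl

@[simp] theorem outputs_some (d : Data) (t : Trace) :
    outputs (some d :: t) = d :: outputs t := rfl

@[simp] theorem outputs_nil : outputs [] = [] := rfl

@[simp] theorem outputs_replicate (a : ℕ) : outputs (List.replicate a none) = [] :=
  List.reduceOption_replicate_none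

/-- Simulation: the registers of `c` live from `K + 1` on, `K` keeps the second datum `D` of the
decoder, and below `K` is the decoder's workspace. Since `cg` changes nothing from `K` on, the
stores correspond again after every output. -/
theorem exec_translate {cg : Cmd} {K : ℕ} (hK : 0 < K) {D : Data}
    (hcg : ∀ x, Call cg K (.cons D (code x)) (Data.ofOption (h x)) B)
    {c : Cmd} {s s' : Store} {t : Trace} (H : Exec c s t s') :
    ∀ (σ : Store) (l : List ι), (∀ r, σ (r + (K + 1)) = s r) → σ K = D →
      outputs t = l.map code → ∃ (t' : Trace) (σ' : Store), Exec (c.translate cg K) σ t' σ' ∧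
        (∀ r, σ' (r + (K + 1)) = s' r) ∧ σ' K = D ∧ Translates code h (B + 3) t l t' := by
  induction H with
  | skip s =>
    intro σ l h1 h2 h3
    obtain rfl : l = [] := by simpa using h3.symm
    exact ⟨_, σ, Exec.skip σ, h1, h2, .none .nil⟩
  | assign s r e =>
    intro σ l h1 h2 h3
    obtain rfl : l = [] := by simpa using h3.symm
    refine ⟨_, _, Exec.assign _ _ _, fun r' => ?_, ?_, .none .nil⟩
    · rw [Expr.eval_shift h1]
      by_cases hr : r' = r
      · subst hr; simp
      · rw [Function.update_of_ne (by omega), Function.update_of_ne hr, h1]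
    · rw [Function.update_of_ne (by omega), h2]
  | emit s e =>
    intro σ l h1 h2 h3
    obtain ⟨x, rfl, hx⟩ : ∃ x, l = [x] ∧ e.eval s = code x := by
      rcases l with _ | ⟨x, _ | ⟨y, l⟩⟩ <;> simp at h3
      exact ⟨x, rfl, h3⟩
    have r0 := Run.assign σ 0 (.cons (.var K) (e.shift (K + 1)))
    obtain ⟨a, σ₁, r1, v1, p1, b1⟩ := hcg x _
      (show Function.update σ 0 ((Expr.cons (.var K) (e.shift (K + 1))).eval σ) 0 = _ by
        simp [Expr.eval, Expr.eval_shift h1, h2, hx])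
    have p : ∀ r, K ≤ r → σ₁ r = σ r := fun r hr => by
      rw [p1 r hr, Function.update_of_ne (by omega)]
    rw [hx]
    cases hh : h x with
    | none =>
      refine ⟨_, σ₁, r0.seq (r1.seq (Run.iteFalse (by simp [Expr.eval, v1, hh, Data.ofOption])
        (Run.skip σ₁))), fun r => by rw [p _ (by omega), h1], by rw [p _ le_rfl, h2], ?_⟩
      -- A rejected item costs three steps besides the call: the assignment of the argument, the
      -- test and `skip`. This is the `3` in `B + 3`.
      have := (Translates.nil (code := code) (h := h) (B := B + 3)).item x
        (1 + (a + (1 + 1))) (by omega)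
      simpa [hh] using this
    | some y =>
      have r2 : Exec (.ite (.var 0) (.emit (.tl (.var 0))) .skip) σ₁ [none, some y] σ₁ := by
        have := Exec.emit σ₁ (.tl (.var 0))
        simp only [Expr.eval, v1, hh, Data.ofOption, Data.tl_cons] at this
        exact Exec.iteTrue (by simp [Expr.eval, v1, hh, Data.ofOption]) this
      refine ⟨_, σ₁, Exec.seq r0 (Exec.seq r1 r2), fun r => by rw [p _ (by omega), h1],
        by rw [p _ le_rfl, h2], ?_⟩
      have := (Translates.nil (code := code) (h := h) (B := B + 3)).item x
        (1 + (a + 1)) (by omega)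
      simpa [hh, List.replicate_add] using this
  | seq _ _ ih₁ ih₂ =>
    intro σ l h1 h2 h3
    rw [outputs_append] at h3
    obtain ⟨l₁, l₂, rfl, e1, e2⟩ := List.map_eq_append_iff.1 h3.symm
    obtain ⟨t₁, σ₁, x1, a1, b1, c1⟩ := ih₁ σ l₁ h1 h2 e1.symm
    obtain ⟨t₂, σ₂, x2, a2, b2, c2⟩ := ih₂ σ₁ l₂ a1 b1 e2.symm
    exact ⟨_, σ₂, Exec.seq x1 x2, a2, b2, c1.append c2⟩
  | iteTrue he _ ih =>
    intro σ l h1 h2 h3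
    obtain ⟨t₁, σ₁, x1, a1, b1, c1⟩ := ih σ l h1 h2 h3
    exact ⟨_, σ₁, Exec.iteTrue (by rwa [Expr.eval_shift h1]) x1, a1, b1, c1.none⟩
  | iteFalse he _ ih =>
    intro σ l h1 h2 h3
    obtain ⟨t₁, σ₁, x1, a1, b1, c1⟩ := ih σ l h1 h2 h3
    exact ⟨_, σ₁, Exec.iteFalse (by rwa [Expr.eval_shift h1]) x1, a1, b1, c1.none⟩
  | loopFalse he =>
    intro σ l h1 h2 h3
    obtain rfl : l = [] := by simpa using h3.symm
    exact ⟨_, σ, Exec.loopFalse (by rwa [Expr.eval_shift h1]), h1, h2, .none .nil⟩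
  | loopTrue he _ _ ih₁ ih₂ =>
    intro σ l h1 h2 h3
    rw [outputs_none, outputs_append] at h3
    obtain ⟨l₁, l₂, rfl, e1, e2⟩ := List.map_eq_append_iff.1 h3.symm
    obtain ⟨t₁, σ₁, x1, a1, b1, c1⟩ := ih₁ σ l₁ h1 h2 e1.symm
    obtain ⟨t₂, σ₂, x2, a2, b2, c2⟩ := ih₂ σ₁ l₂ a1 b1 e2.symm
    exact ⟨_, σ₂, Exec.loopTrue (by rwa [Expr.eval_shift h1]) x1 x2, a2, b2,
      (c1.append c2).none⟩

/-! ### Running time and number of outputs of a translated trace. -/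

/-- The number of rejected items. -/
def rejected (h : ι → Option Data) (l : List ι) : ℕ := l.countP fun x => (h x).isNone

namespace Translates

variable {t t' : Trace} {l : List ι}

theorem mono (H : Translates code h B t l t') {B' : ℕ} (hB : B ≤ B') :
    Translates code h B' t l t' := by
  induction H with
  | nil => exact .nil
  | none _ ih => exact ih.none
  | item x a ha _ ih => exact ih.item x a (ha.trans hB)

theorem outputs_left (H : Translates code h B t l t') : outputs t = l.map code := by
  induction H with
  | nil => rfl
  | none _ ih => exact ih
  | item x a _ _ ih => simp [ih]

theorem outputs_right (H : Translates code h B t l t') : outputs t' = l.filterMap h := by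
  induction H with
  | nil => rfl
  | none _ ih => exact ih
  | item x a _ _ ih => cases hx : h x <;> simp [hx, ih]

theorem length_eq (h : ι → Option Data) (l : List ι) :
    l.length = (l.filterMap h).length + rejected h l := by
  induction l with
  | nil => rfl
  | cons x l ih => cases hx : h x <;> simp_all [rejected] <;> omega

theorem length_outputs (H : Translates code h B t l t') :
    (outputs t).length = (outputs t').length + rejected h l := by
  rw [H.outputs_left, H.outputs_right, List.length_map, length_eq h l]

theorem length_le (H : Translates code h B t l t') : t'.length ≤ (B + 1) * t.length := by
  induction H with
  | nil => simp
  | none _ ih => simp only [List.length_cons, mul_add]; omega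
  | item x a ha _ ih =>
    have : (h x).toList.length ≤ 1 := by cases h x <;> simp
    simp only [List.length_append, List.length_replicate, List.length_map, List.length_cons,
      mul_add]
    omega

/-- An output of the translated run stems from an output of the original run, before which at most
the rejected items were output in addition. So the `k`-th accepted item is found early enough for
incremental time. -/
theorem split (H : Translates code h B t l t') {t₁' t₂' : Trace} {d : Data}
    (e : t' = t₁' ++ some d :: t₂') : ∃ (t₁ t₂ : Trace) (d' : Data), t = t₁ ++ some d' :: t₂ ∧
      t₁'.length + 1 ≤ (B + 1) * (t₁.length + 1) ∧
      (outputs t₁).length ≤ (outputs t₁').length + rejected h l := by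
  induction H generalizing t₁' with
  | nil => simp at e
  | none _ ih =>
    rcases t₁' with _ | ⟨x, t₁'⟩
    · simp at e
    · obtain ⟨rfl, e₀⟩ := List.cons_eq_cons.1 (e.trans (List.cons_append ..))
      obtain ⟨t₁, t₂, d', e', h1, h2⟩ := ih e₀
      refine ⟨.none :: t₁, t₂, d', by rw [e']; rfl, ?_, by simpa using h2⟩
      simp only [List.length_cons, mul_add] at h1 ⊢
      omega
  | @item t l t' x a ha _ ih =>
    rw [← List.append_assoc] at e
    have hlen : (List.replicate a Option.none ++ (h x).toList.map some).length ≤ B + 1 := by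
      have : (h x).toList.length ≤ 1 := by cases h x <;> simp
      simp only [List.length_append, List.length_replicate, List.length_map]
      omega
    rcases List.append_eq_append_iff.1 e with ⟨as, rfl, e'⟩ | ⟨bs, e₁, e₂⟩
    · obtain ⟨t₁, t₂, d', e', h1, h2⟩ := ih e'
      refine ⟨some (code x) :: t₁, t₂, d', by rw [e']; rfl, ?_, ?_⟩
      · rw [List.length_append]
        simp only [List.length_cons, mul_add] at h1 ⊢
        omega
      · cases hx : h x <;> simp_all [rejected] <;> omega
    -- For empty `bs` the block of `x` ends just before the output, which belongs to the remaining
    -- trace; otherwise the output is the translation of `x` itself.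
    · rcases bs with _ | ⟨y, bs⟩
      · obtain ⟨t₁, t₂, d', e', h1, h2⟩ := ih (t₁' := []) (by simpa using e₂.symm)
        refine ⟨some (code x) :: t₁, t₂, d', by rw [e']; rfl, ?_, ?_⟩
        · rw [List.append_nil] at e₁
          rw [← e₁]
          simp only [List.length_cons, mul_add] at h1 ⊢
          omega
        · rw [List.append_nil] at e₁
          rw [← e₁]
          simp only [rejected] at h2 ⊢
          cases hx : h x <;> simp [hx] at h2 ⊢ <;> omega
      · refine ⟨[], t, code x, rfl, ?_, by simp⟩
        rw [e₁] at hlen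
        simp only [List.length_append, List.length_cons] at hlen
        simp only [List.length_nil]
        omega

end Translates

/-! ### Delay of a translated trace. -/

/-- The number of leading silent steps. -/
def lead : Trace → ℕ
  | [] => 0
  | none :: t => lead t + 1
  | some _ :: _ => 0

/-- The greatest number of consecutive silent steps. -/
def maxDelay : Trace → ℕ
  | [] => 0
  | x :: t => max (lead (x :: t)) (maxDelay t)

theorem lead_le_maxDelay (t : Trace) : lead t ≤ maxDelay t := by
  cases t with
  | nil => exact le_rfl
  | cons x t => exact le_max_left _ _

theorem lead_replicate (a : ℕ) (t : Trace) :
    lead (List.replicate a none ++ t) = a + lead t := by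
  induction a with
  | zero => simp
  | succ a ih => simp [List.replicate_succ, lead, ih]; omega

theorem maxDelay_replicate (a : ℕ) (t : Trace) :
    maxDelay (List.replicate a none ++ t) = max (a + lead t) (maxDelay t) := by
  induction a with
  | zero => simpa using lead_le_maxDelay t
  | succ a ih =>
    simp only [List.replicate_succ, List.cons_append, maxDelay, lead, ih, lead_replicate]
    omega

theorem maxDelay_append_right (t t' : Trace) : maxDelay t' ≤ maxDelay (t ++ t') := by
  induction t with
  | nil => exact le_rfl
  | cons x t ih => exact ih.trans (le_max_right _ _)

/-- Replaces the decompositions in the definition of `PolyDelay` by a recursive quantity on which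
one can do induction. -/
theorem maxDelay_le_iff {t : Trace} {D : ℕ} : maxDelay t ≤ D ↔
    ∀ (t₁ t₂ : Trace) (k : ℕ), t = t₁ ++ List.replicate k none ++ t₂ → k ≤ D := by
  constructor
  · rintro h t₁ t₂ k rfl
    rw [List.append_assoc] at h
    have h1 := (maxDelay_append_right t₁ _).trans h
    rw [maxDelay_replicate] at h1
    omega
  · have hl : ∀ t : Trace, ∃ t₂, t = List.replicate (lead t) none ++ t₂ := by
      intro t
      induction t with
      | nil => exact ⟨[], rfl⟩
      | cons x t ih =>
        cases x with
        | none =>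
          obtain ⟨t₂, h⟩ := ih
          exact ⟨t₂, by rw [lead, List.replicate_succ, List.cons_append, ← h]⟩
        | some d => exact ⟨some d :: t, rfl⟩
    induction t with
    | nil => simp [maxDelay]
    | cons x t ih =>
      intro h
      refine max_le ?_ (ih fun t₁ t₂ k e => h (x :: t₁) t₂ k (by rw [e]; rfl))
      obtain ⟨t₂, e⟩ := hl (x :: t)
      exact h [] t₂ _ e

namespace Translates

variable {t t' : Trace} {l : List ι}

/-- The leading silent run ends only at an accepted item. Each rejected item that it crosses adds at
most `B` steps of translation and the next silent run of `t`; the last `B` pays for the silent part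
of an accepted item. -/
theorem lead_le (H : Translates code h B t l t') :
    lead t' ≤ lead t + rejected h l * (maxDelay t + B) + B := by
  induction H with
  | nil => simp [lead]
  | @none t l t' _ ih =>
    have := Nat.mul_le_mul_left (rejected h l)
      (Nat.add_le_add_right (le_max_right (lead (.none :: t)) (maxDelay t)) B)
    simp only [lead, maxDelay] at this ⊢
    omega
  | @item t l t' x a ha _ ih =>
    rw [lead_replicate]
    cases hx : h x with
    | some y => simp [lead]; omega
    | none =>
      have h1 : rejected h (x :: l) = rejected h l + 1 := by simp [rejected, hx]
      have h2 := lead_le_maxDelay t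
      have h3 : maxDelay (some (code x) :: t) = maxDelay t := by simp [maxDelay, lead]
      rw [h1, h3, add_mul, one_mul]
      simp only [Option.toList_none, List.map_nil, List.nil_append]
      omega

/-- A silent run that crosses all rejected items joins at most `rejected h l + 1` silent runs of
`t`, with at most `B` further steps for each item on the way and for the item that ends it. -/
theorem maxDelay_le (H : Translates code h B t l t') :
    maxDelay t' ≤ (rejected h l + 1) * (maxDelay t + B) + B := by
  induction H with
  | nil => simp [maxDelay]
  | @none t l t' H ih =>
    have h0 := H.none.lead_le
    have h1 := lead_le_maxDelay (.none :: t)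
    have h2 := Nat.mul_le_mul_left (rejected h l + 1)
      (Nat.add_le_add_right (le_max_right (lead (.none :: t)) (maxDelay t)) B)
    rw [maxDelay]
    refine max_le ?_ (by rw [maxDelay]; omega)
    rw [add_mul, one_mul]
    omega
  | @item t l t' x a ha H ih =>
    have h3 : maxDelay (some (code x) :: t) = maxDelay t := by simp [maxDelay, lead]
    rw [maxDelay_replicate, h3]
    cases hx : h x with
    | some y =>
      have h1 : rejected h (x :: l) = rejected h l := by simp [rejected, hx]
      rw [h1]
      simp [maxDelay, lead]
      omega
    | none =>
      have h1 : rejected h (x :: l) = rejected h l + 1 := by simp [rejected, hx]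
      have h2 := lead_le_maxDelay t'
      rw [h1, add_mul (_ + 1), one_mul]
      simp only [Option.toList_none, List.map_nil, List.nil_append]
      omega

end Translates

end Translates

/-! ### Reductions transfer algorithms -/

namespace EnumProblem

/-- A reduction turns every program for `P` into one for `Q` whose traces are translations of
those of the program for `P`. -/
theorem PolyReduction.exists_program {Q P : EnumProblem} (R : PolyReduction Q P) (c : Cmd) :
    ∃ (f : Q.Inst → P.Inst) (c' : Cmd) (p : Polynomial ℕ), ∀ i : Q.Inst,
      P.size (f i) ≤ p.eval (Q.size i) ∧
      ∀ (t : Trace) (s : Store), Exec c (initStore (P.code (f i))) t s → P.Correct (f i) t →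
        ∃ (h : P.Item (f i) → Option Data) (l : List (P.Item (f i))) (a : ℕ) (t' : Trace)
          (s' : Store), Exec c' (initStore (Q.code i)) (List.replicate a none ++ t') s' ∧
          Q.Correct i (List.replicate a none ++ t') ∧
          Translates (P.itemCode (f i)) h (p.eval (Q.size i)) t l t' ∧
          rejected h l ≤ p.eval (Q.size i) ∧ a ≤ p.eval (Q.size i) := by
  obtain ⟨f, g, cf, cg, p, hsize, hf, hg, hS⟩ := R
  set K := max (cf.bound + 1) (cg.bound + 1) with hK
  -- Register `K` keeps the code of `i` for the decoder, and `K + 1` is register `0` of the shifted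
  -- program `c`. The added constant covers the `cf.bound + 3` extra steps of the prologue as well
  -- as the overhead `cg.bound + 4` of an output.
  refine ⟨f, .seq (.assign K (.var 0)) (.seq cf.subroutine (.seq (.assign (K + 1) (.var 0))
    (c.translate cg.subroutine K))), p + Polynomial.C (cf.bound + cg.bound + 4), fun i => ?_⟩
  simp only [Polynomial.eval_add, Polynomial.eval_C]
  refine ⟨(hsize i).trans (Nat.le_add_right _ _), fun t s H ⟨l, hl, hans, hout⟩ => ?_⟩
  obtain ⟨tf, sf, xf, vf, bf⟩ := hf i
  obtain ⟨hA, hinj, hrej⟩ := hS i _ hans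
  have r0 := Run.assign (initStore (Q.code i)) K (.var 0)
  obtain ⟨a, σ₁, r1, v1, p1, b1⟩ := call_subroutine xf
    (Function.update (initStore (Q.code i)) K ((Expr.var 0).eval (initStore (Q.code i))))
    (by rw [Function.update_of_ne (by omega)]; simp [initStore])
  have r2 := Run.assign σ₁ (K + 1) (.var 0)
  obtain ⟨t', s', x', -, -, H'⟩ := exec_translate (cg := cg.subroutine) (K := K)
    (D := Q.code i) (code := P.itemCode (f i)) (h := fun x => (g i x).map (Q.itemCode i))
    (B := cg.bound + 1 + p.eval (Q.size i)) (by omega) (fun x => by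
      obtain ⟨tg, sg, xg, vg, bg⟩ := hg i x
      rw [← vg]
      exact (call_subroutine xg).mono (by omega) (by omega)) H
    (Function.update σ₁ (K + 1) ((Expr.var 0).eval σ₁)) l
    (fun r => by
      rcases Nat.eq_zero_or_pos r with rfl | hr
      · rw [Nat.zero_add, Function.update_self]
        simp [Expr.eval, v1, vf, initStore]
      · rw [Function.update_of_ne (by omega), p1 _ (by omega), Function.update_of_ne (by omega),
          initStore, initStore, Function.update_of_ne (by omega), Function.update_of_ne (by omega)])
    (by rw [Function.update_of_ne (by omega), p1 _ (by omega), Function.update_self]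
        simp [Expr.eval, initStore])
    hout
  have hmap : l.filterMap (fun x => (g i x).map (Q.itemCode i)) =
      (l.filterMap (g i)).map (Q.itemCode i) := by
    rw [List.map_filterMap]
  refine ⟨fun x => (g i x).map (Q.itemCode i), l, 1 + (a + 1), t', s', ?_,
    ⟨l.filterMap (g i), ?_, ?_, ?_⟩, H'.mono (by omega), ?_, by omega⟩
  · rw [List.replicate_add, List.replicate_add, List.append_assoc, List.append_assoc]
    exact Exec.seq r0 (Exec.seq r1 (Exec.seq r2 x'))
  · refine List.pairwise_filterMap.2 (hl.imp_of_mem ?_)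
    intro x x' hx hx' hne y hy y' hy' hyy
    subst hyy
    exact hne (hinj x hx x' hx' y hy hy')
  · convert hA using 1
    ext y
    simp
  · simp [H'.outputs_right, hmap]
  · classical
    have e : {x | x ∈ l ∧ g i x = none} = ((l.filter fun x => (g i x).isNone).toFinset : Set _) := by
      ext x
      simp
    have h1 : rejected (fun x => (g i x).map (Q.itemCode i)) l =
        (l.filter fun x => (g i x).isNone).toFinset.card := by
      rw [List.toFinset_card_of_nodup (hl.filter _), rejected, List.countP_eq_length_filter]
      simp
    have h2 : ((rejected (fun x => (g i x).map (Q.itemCode i)) l : ℕ) : ℕ∞) ≤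
        (p.eval (Q.size i) : ℕ) := by
      rw [h1, ← Set.encard_coe_eq_coe_finsetCard, ← e]
      exact hrej
    exact (Nat.cast_le.1 h2).trans (Nat.le_add_right _ _)

variable {Q P : EnumProblem}

theorem PolyReduction.outputPoly (R : PolyReduction Q P) : P.OutputPoly → Q.OutputPoly := by
  rintro ⟨c, q, hq⟩
  obtain ⟨f, c', p, hp⟩ := R.exists_program c
  -- The first `p` pays for the prologue and `p + 1` for each simulated step. The argument of `q`
  -- adds the size of `f i`, the input and accepted outputs, and the rejected outputs.
  refine ⟨c', p + (p + 1) * q.comp (p + .X + p), fun i => ?_⟩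
  obtain ⟨hs, hp⟩ := hp i
  obtain ⟨t, s, x, hc, hlen⟩ := hq (f i)
  obtain ⟨h, l, a, t', s', x', hc', H, hr, ha⟩ := hp t s x hc
  refine ⟨_, s', x', hc', ?_⟩
  have h1 := H.length_le
  have h2 := H.length_outputs
  have hmono := eval_mono p (Nat.le_add_right (Q.size i) (outputs t').length)
  have h3 := hlen.trans (eval_mono q (n := p.eval (Q.size i + (outputs t').length) +
    (Q.size i + (outputs t').length) + p.eval (Q.size i + (outputs t').length)) (by omega))
  have h4 := h1.trans (Nat.mul_le_mul (Nat.add_le_add_right hmono 1) h3)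
  simp
  omega

theorem PolyReduction.incrementalPoly (R : PolyReduction Q P) :
    P.IncrementalPoly → Q.IncrementalPoly := by
  rintro ⟨c, q, hq⟩
  obtain ⟨f, c', p, hp⟩ := R.exists_program c
  refine ⟨c', p + (p + 1) * q.comp (p + .X + p), fun i => ?_⟩
  obtain ⟨hs, hp⟩ := hp i
  obtain ⟨t, s, x, hc, hinc, hlen⟩ := hq (f i)
  obtain ⟨h, l, a, t', s', x', hc', H, hr, ha⟩ := hp t s x hc
  -- One estimate for the time of an output and for the halting time: `m` steps of the original run,
  -- `n` original outputs, `u` accepted ones.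
  have key : ∀ m n u : ℕ, m ≤ q.eval (P.size (f i) + (n + 1)) → n ≤ u + rejected h l →
      a + (p.eval (Q.size i) + 1) * m ≤
        (p + (p + 1) * q.comp (p + .X + p)).eval (Q.size i + (u + 1)) := by
    intro m n u hm hn
    have hmono := eval_mono p (Nat.le_add_right (Q.size i) (u + 1))
    have h3 := hm.trans (eval_mono q (n := p.eval (Q.size i + (u + 1)) +
      (Q.size i + (u + 1)) + p.eval (Q.size i + (u + 1))) (by omega))
    have h4 := Nat.mul_le_mul (Nat.add_le_add_right hmono 1) h3
    simp
    omega
  refine ⟨_, s', x', hc', fun t₁ t₂ d e => ?_, ?_⟩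
  -- The prologue is silent, so it lies entirely before the output considered.
  · obtain ⟨t₁', rfl, e'⟩ : ∃ t₁', t₁ = List.replicate a none ++ t₁' ∧
        t' = t₁' ++ some d :: t₂ := by
      rcases List.append_eq_append_iff.1 e with ⟨as, rfl, e'⟩ | ⟨bs, e₁, e₂⟩
      · exact ⟨as, rfl, e'⟩
      · rcases bs with _ | ⟨y, bs⟩
        · exact ⟨[], by simpa using e₁.symm, by simpa using e₂.symm⟩
        · have : some d ∈ List.replicate a none := by
            rw [e₁, (List.cons_eq_cons.1 (e₂.trans (List.cons_append ..))).1]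
            simp
          simp at this
    obtain ⟨u₁, u₂, d', eu, h1, h2⟩ := H.split e'
    have := key _ _ _ (hinc u₁ u₂ d' eu) h2
    simp only [List.length_append, List.length_replicate, outputs_append, outputs_replicate,
      List.nil_append] at this ⊢
    omega
  · have := key _ _ _ hlen H.length_outputs.le
    have h1 := H.length_le
    simp only [List.length_append, List.length_replicate, outputs_append, outputs_replicate,
      List.nil_append] at this ⊢
    omega

/-- Only the first silent run is prolonged by the prologue; elsewhere the bound
`Translates.maxDelay_le` applies directly. -/
theorem PolyReduction.polyDelay (R : PolyReduction Q P) : P.PolyDelay → Q.PolyDelay := by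
  rintro ⟨c, q, hq⟩
  obtain ⟨f, c', p, hp⟩ := R.exists_program c
  refine ⟨c', p + ((p + 1) * (q.comp p + p) + p), fun i => ?_⟩
  obtain ⟨hs, hp⟩ := hp i
  obtain ⟨t, s, x, hc, hdel⟩ := hq (f i)
  obtain ⟨h, l, a, t', s', x', hc', H, hr, ha⟩ := hp t s x hc
  refine ⟨_, s', x', hc', maxDelay_le_iff.1 ?_⟩
  have h1 := (maxDelay_le_iff.2 hdel).trans (eval_mono q hs)
  have h2 := H.maxDelay_le
  have h3 := Nat.mul_le_mul (Nat.add_le_add_right hr 1)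
    (Nat.add_le_add_right h1 (p.eval (Q.size i)))
  have h4 := lead_le_maxDelay t'
  rw [maxDelay_replicate]
  simp
  omega

theorem PolyReduction.atLeastAsHard (R : PolyReduction Q P) : AtLeastAsHard P Q :=
  ⟨R, R.outputPoly, R.incrementalPoly, R.polyDelay⟩

/-- Polynomial-time functions on the codes give a reduction. -/
theorem PolyReduction.of_polytime (f : Q.Inst → P.Inst)
    (g : (i : Q.Inst) → P.Item (f i) → Option (Q.Item i)) {φ ψ : Data → Data}
    (hφ : Polytime φ) (hψ : Polytime ψ) (hf : ∀ i, φ (Q.code i) = P.code (f i))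
    (hg : ∀ i x, ψ (.cons (Q.code i) (P.itemCode (f i) x)) =
      Data.ofOption ((g i x).map (Q.itemCode i)))
    (hsize : PolyBounded Q.size fun i => P.size (f i))
    (hcode : PolyBounded Q.size fun i => (Q.code i).size)
    (hitem : PolyBounded (fun ix : (i : Q.Inst) × P.Item (f i) => Q.size ix.1)
      fun ix => (P.itemCode (f ix.1) ix.2).size)
    {r : Q.Inst → ℕ} (hr : PolyBounded Q.size r)
    (hS : ∀ (i : Q.Inst) (S : Set (P.Item (f i))), P.IsAnswer (f i) S →
      Q.IsAnswer i {y | ∃ x ∈ S, g i x = some y} ∧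
      (∀ x ∈ S, ∀ x' ∈ S, ∀ y, g i x = some y → g i x' = some y → x = x') ∧
      {x ∈ S | g i x = none}.encard ≤ r i) : PolyReduction Q P := by
  obtain ⟨cf, kf, Tf, -, ⟨qf, hTf⟩, -, hcf⟩ := hφ
  obtain ⟨cg, kg, Tg, -, ⟨qg, hTg⟩, -, hcg⟩ := hψ
  obtain ⟨p₁, h₁⟩ := hsize
  obtain ⟨p₂, h₂⟩ := hcode
  obtain ⟨p₃, h₃⟩ := hitem
  obtain ⟨p₄, h₄⟩ := hr
  refine ⟨f, g, cf, cg, p₁ + qf.comp p₂ + qg.comp (1 + p₂ + p₃) + p₄, fun i => ?_, fun i => ?_,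
    fun i x => ?_, fun i S h => ⟨(hS i S h).1, (hS i S h).2.1, (hS i S h).2.2.trans ?_⟩⟩
  · have := h₁ i
    simp at this ⊢
    omega
  · obtain ⟨a, σ, r, v, -, b⟩ := hcf (Q.code i) (initStore (Q.code i)) (by simp [initStore])
    refine ⟨_, σ, r, v.trans (hf i), ?_⟩
    have := (b.trans (hTf _)).trans (eval_mono qf (h₂ i))
    simp
    omega
  · obtain ⟨a, σ, r, v, -, b⟩ := hcg (.cons (Q.code i) (P.itemCode (f i) x))
      (initStore (.cons (Q.code i) (P.itemCode (f i) x))) (by simp [initStore])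
    refine ⟨_, σ, r, v.trans (hg i x), ?_⟩
    have := (b.trans (hTg _)).trans (eval_mono qg (n := 1 + p₂.eval (Q.size i) +
      p₃.eval (Q.size i)) (by
        have := h₂ i
        have := h₃ ⟨i, x⟩
        simp only [Data.size_cons] at *
        omega))
    simp
    omega
  · have := h₄ i
    refine Nat.cast_le.2 ?_
    simp
    omega

end EnumProblem

/-! ### Implicational bases with a single conclusion -/

/-- The implicational base `{e → z : e ∈ F}`. -/
def starBase {α : Type*} (z : α) (F : Set (Finset α)) : Set (Implication α) :=
  (fun e => ⟨e, {z}⟩) '' F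

section StarBase

variable {α : Type*} {z : α} {F : Set (Finset α)}

theorem mem_closedSets_starBase {C : Finset α} :
    C ∈ closedSets (starBase z F) ↔ z ∈ C ∨ ∀ e ∈ F, ¬ e ⊆ C := by
  simp only [closedSets, starBase, Set.mem_ofPred_eq, Set.forall_mem_image,
    Finset.singleton_subset_iff]
  by_cases h : z ∈ C <;> simp [h]

/-- As `z` lies in no premise, all arcs enter `z` and none leaves it, so no two arcs can be
composed. Acyclicity and the height both rest on this. -/
theorem arc_starBase (hz : ∀ e ∈ F, z ∉ e) {a b : α} (h : Arc (starBase z F) a b) :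
    a ≠ z ∧ b = z := by
  obtain ⟨_, ⟨e, he, rfl⟩, ha, hb⟩ := h
  exact ⟨fun h => hz e he (h ▸ ha), Finset.mem_singleton.1 hb⟩

theorem isAcyclicBase_starBase (hz : ∀ e ∈ F, z ∉ e) : IsAcyclicBase (starBase z F) := by
  intro a h
  have h1 : ∀ {a b}, Relation.TransGen (Arc (starBase z F)) a b → a ≠ z ∧ b = z := by
    intro a b h
    induction h with
    | single h => exact arc_starBase hz h
    | tail _ h ih => exact ⟨ih.1, (arc_starBase hz h).2⟩
  exact (h1 h).1 (h1 h).2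

theorem hasHeight_starBase (hz : ∀ e ∈ F, z ∉ e) (hne : F.Nonempty) (he : ∅ ∉ F) :
    HasHeight (starBase z F) 2 := by
  constructor
  · obtain ⟨e, hF⟩ := hne
    obtain ⟨a, ha⟩ := Finset.nonempty_iff_ne_empty.2 fun h => he (h ▸ hF)
    exact ⟨[a, z], by simpa using ⟨_, ⟨e, hF, rfl⟩, ha, Finset.mem_singleton_self z⟩, rfl⟩
  · intro l hl
    rcases l with _ | ⟨a, _ | ⟨b, _ | ⟨c, l⟩⟩⟩
    · simp
    · simp
    · simp
    · simp only [List.isChain_cons_cons] at hl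
      exact absurd (arc_starBase hz hl.1).2 (arc_starBase hz hl.2.1).1

theorem mem_irrAt {C : Set (Finset α)} {x : α} {M : Finset α} :
    M ∈ irrAt C x ↔ Maximal (fun M : Finset α => M ∈ C ∧ x ∉ M) M := Iff.rfl

theorem irrAt_starBase : irrAt (closedSets (starBase z F)) z =
    {M | Maximal (fun M : Finset α => z ∉ M ∧ ∀ e ∈ F, ¬ e ⊆ M) M} := by
  have : (fun M : Finset α => M ∈ closedSets (starBase z F) ∧ z ∉ M) =
      fun M => z ∉ M ∧ ∀ e ∈ F, ¬ e ⊆ M := by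
    funext M
    rw [mem_closedSets_starBase]
    exact propext ⟨fun h => ⟨h.2, h.1.resolve_left h.2⟩, fun h => ⟨.inr h.2, h.1⟩⟩
  rw [irrAt, this]

variable [Fintype α] [DecidableEq α]

/-- Every set containing `z` is closed, so a closed set grows by `z` first and by arbitrary elements
afterwards. The hypothesis is needed for `∅` to be closed. -/
theorem isConvexGeometry_starBase (he : ∅ ∉ F) :
    IsConvexGeometry (closedSets (starBase z F)) := by
  refine ⟨⟨by simp [mem_closedSets_starBase], fun A hA B hB => ?_⟩, ?_, fun A hA hne => ?_⟩
  · rw [mem_closedSets_starBase] at hA hB ⊢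
    rcases hA with hA | hA
    · rcases hB with hB | hB
      · exact .inl (by simp [hA, hB])
      · exact .inr fun e h h' => hB e h (h'.trans Finset.inter_subset_right)
    · exact .inr fun e h h' => hA e h (h'.trans Finset.inter_subset_left)
  · rw [mem_closedSets_starBase]
    refine .inr fun e h h' => he ?_
    rwa [Finset.subset_empty.1 h'] at h
  · by_cases hz : z ∈ A
    · obtain ⟨x, hx⟩ := not_forall.1 fun h => hne (Finset.eq_univ_iff_forall.2 h)
      exact ⟨x, hx, mem_closedSets_starBase.2 (.inl (by simp [hz]))⟩
    · exact ⟨z, hz, mem_closedSets_starBase.2 (.inl (by simp))⟩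

theorem isHeightTwoBase_starBase {n : ℕ} {z : Fin n} {F : Set (Finset (Fin n))}
    (hz : ∀ e ∈ F, z ∉ e) (hne : F.Nonempty) (he : ∅ ∉ F) : IsHeightTwoBase (starBase z F) :=
  ⟨isConvexGeometry_starBase he, isAcyclicBase_starBase hz, hasHeight_starBase hz hne he⟩

/-- All sets containing `z` are closed, so such a set missing two elements is an intersection of two
larger ones. An irreducible `M` without `z` is maximal, because a closed `M' ⊇ M` without `z` gives
`M = (M ∪ {z}) ∩ M'`. Conversely, closed sets properly above a maximal one contain `z`, and so does
their intersection. -/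
theorem irr_starBase : irr (closedSets (starBase z F)) =
    irrAt (closedSets (starBase z F)) z ∪ {M | ∃ x, x ≠ z ∧ M = Finset.univ.erase x} := by
  have hcl : ∀ C : Finset α, z ∈ C → C ∈ closedSets (starBase z F) := fun C h =>
    mem_closedSets_starBase.2 (.inl h)
  ext M
  constructor
  · rintro ⟨hM, hne, hirr⟩
    by_cases hz : z ∈ M
    · right
      obtain ⟨x, hx⟩ := not_forall.1 fun h => hne (Finset.eq_univ_iff_forall.2 h)
      refine ⟨x, fun h => hx (h ▸ hz), ?_⟩
      by_contra hM'
      obtain ⟨y, hy, hyM⟩ : ∃ y, y ≠ x ∧ y ∉ M := by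
        by_contra! hall
        refine hM' (Finset.ext fun y => ?_)
        rw [Finset.mem_erase]
        exact ⟨fun h => ⟨fun h' => hx (h' ▸ h), Finset.mem_univ _⟩, fun h => hall y h.1⟩
      rcases hirr (insert x M) (hcl _ (by simp [hz])) (insert y M) (hcl _ (by simp [hz])) (by
        ext w
        simp only [Finset.mem_inter, Finset.mem_insert]
        grind) with h | h
      · exact hx (h ▸ Finset.mem_insert_self x M)
      · exact hyM (h ▸ Finset.mem_insert_self y M)
    · left
      refine ⟨⟨hM, hz⟩, fun M' hM' hle => ?_⟩
      rcases hirr (insert z M) (hcl _ (by simp)) M' hM'.1 (by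
        ext w
        have := @hle w
        have := hM'.2
        simp only [Finset.mem_inter, Finset.mem_insert]
        grind) with h | h
      · exact absurd (h ▸ Finset.mem_insert_self z M) hz
      · exact h.le
  · rintro (hM | ⟨x, hx, rfl⟩)
    · rw [mem_irrAt] at hM
      refine ⟨hM.prop.1, fun h => hM.prop.2 (h ▸ Finset.mem_univ z), fun A hA B hB e => ?_⟩
      by_contra! h
      have key : ∀ C ∈ closedSets (starBase z F), M ⊆ C → C ≠ M → z ∈ C := by
        intro C hC hMC hne
        by_contra hz
        exact hne (hM.eq_of_le ⟨hC, hz⟩ hMC).symm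
      refine hM.prop.2 ?_
      rw [e]
      exact Finset.mem_inter.2 ⟨key A hA (e ▸ Finset.inter_subset_left) h.1,
        key B hB (e ▸ Finset.inter_subset_right) h.2⟩
    · refine ⟨hcl _ (by simp [hx.symm]), fun h => by simpa using Finset.ext_iff.1 h x,
        fun A _ B _ e => ?_⟩
      have hx' : x ∉ A ∩ B := by rw [← e]; simp
      have hA : Finset.univ.erase x ⊆ A := e ▸ Finset.inter_subset_left
      have hB : Finset.univ.erase x ⊆ B := e ▸ Finset.inter_subset_right
      rw [Finset.mem_inter, not_and_or] at hx'
      refine hx'.imp (fun h => Finset.Subset.antisymm (fun w hw => ?_) hA)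
        (fun h => Finset.Subset.antisymm (fun w hw => ?_) hB)
      · exact Finset.mem_erase.2 ⟨fun h' => h (h' ▸ hw), Finset.mem_univ _⟩
      · exact Finset.mem_erase.2 ⟨fun h' => h (h' ▸ hw), Finset.mem_univ _⟩

theorem irrAt_starBase_subset_irr :
    irrAt (closedSets (starBase z F)) z ⊆ irr (closedSets (starBase z F)) :=
  irr_starBase (z := z) (F := F) ▸ Set.subset_union_left

/-- If the premises form an antichain, the base is the only unit-minimum base. -/
theorem eq_starBase_of_isUnitMinimumBase (hz : ∀ e ∈ F, z ∉ e)
    (hF : ∀ e ∈ F, ∀ e' ∈ F, e ⊆ e' → e = e') {S : Set (Implication α)}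
    (hS : IsUnitMinimumBase S (closedSets (starBase z F))) : S = starBase z F := by
  obtain ⟨hu, hc, hmin⟩ := hS
  have hsub : starBase z F ⊆ S := by
    rintro _ ⟨e, he, rfl⟩
    -- Some implication of `S` fails at `e`. Its conclusion is `z` because `e ∪ {z}` is closed; its
    -- premise is then not closed, so it includes a member of `F`, which by the antichain property
    -- is `e`. Hence the implication is `e → z`.
    have hncl : e ∉ closedSets S := by
      rw [hc, mem_closedSets_starBase]
      rintro (h | h)
      · exact hz e he h
      · exact h e he subset_rfl
    simp only [closedSets, Set.mem_ofPred_eq, not_forall] at hncl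
    obtain ⟨i, hi, hpe, hce⟩ := hncl
    obtain ⟨b, hb⟩ := hu i hi
    have hbe : b ∉ e := by simpa [hb] using hce
    have hcl : ∀ C ∈ closedSets (starBase z F), i.prem ⊆ C → b ∈ C := by
      intro C hC h
      rw [← hc] at hC
      simpa [hb] using hC i hi h
    have hbz : b = z := by
      have := hcl (insert z e) (mem_closedSets_starBase.2 (.inl (by simp)))
        (hpe.trans (Finset.subset_insert _ _))
      exact (Finset.mem_insert.1 this).resolve_right hbe
    subst hbz
    have hp : i.prem ∉ closedSets (starBase b F) := fun h => hbe (hpe (hcl _ h subset_rfl))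
    rw [mem_closedSets_starBase, not_or] at hp
    obtain ⟨e', he', h'⟩ : ∃ e' ∈ F, e' ⊆ i.prem := by simpa using hp.2
    have heq := hF e' he' e he (h'.trans hpe)
    have : i = ⟨e, {b}⟩ := by
      cases i
      simp only [Implication.mk.injEq] at *
      exact ⟨Finset.Subset.antisymm hpe (heq ▸ h'), hb⟩
    rwa [this] at hi
  have hle := hmin (starBase z F) (by rintro _ ⟨e, -, rfl⟩; exact ⟨z, rfl⟩) rfl
  have hfin : (starBase z F).Finite := (Set.toFinite F).image _
  exact (hfin.eq_of_subset_of_encard_le hsub hle).symm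

end StarBase

/-! ### Hypergraphs and their hitting sets -/

section Hypergraph

theorem mem_MIS {V : Type*} {E : Set (Finset V)} {I : Finset V} :
    I ∈ MIS E ↔ Maximal (fun I : Finset V => ∀ e ∈ E, ¬ e ⊆ I) I := Iff.rfl

theorem mem_MHS {V : Type*} {E : Set (Finset V)} {T : Finset V} :
    T ∈ MHS E ↔ Minimal (fun T : Finset V => ∀ e ∈ E, ∃ v ∈ T, v ∈ e) T := Iff.rfl

/-- A set meets an edge iff its complement does not include it, and complementation reverses
inclusion. -/
theorem compl_mem_MHS {V : Type*} [Fintype V] [DecidableEq V] {E : Set (Finset V)}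
    {I : Finset V} : Iᶜ ∈ MHS E ↔ I ∈ MIS E := by
  have h : ∀ I : Finset V, (∀ e ∈ E, ∃ v ∈ Iᶜ, v ∈ e) ↔ ∀ e ∈ E, ¬ e ⊆ I := by
    intro I
    refine forall₂_congr fun e _ => ?_
    rw [Finset.not_subset]
    exact ⟨fun ⟨v, h, h'⟩ => ⟨v, h', Finset.mem_compl.1 h⟩,
      fun ⟨v, h, h'⟩ => ⟨v, Finset.mem_compl.2 h', h⟩⟩
  rw [mem_MHS, mem_MIS]
  constructor
  · intro hI
    refine ⟨(h I).1 hI.prop, fun J hJ hle => ?_⟩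
    exact compl_le_compl_iff_le.1 (hI.le_of_le ((h J).2 hJ) (compl_le_compl hle))
  · intro hI
    refine ⟨(h I).2 hI.prop, fun J hJ hle => ?_⟩
    rw [← compl_compl J] at hJ ⊢
    exact compl_le_compl (hI.le_of_ge ((h Jᶜ).1 hJ) (by simpa using compl_le_compl hle))

/-- The translation of the hypergraph with edges `E` into the base `gadgetBase E`. -/
theorem gadgetBase_eq {V : Type*} (E : Set (Finset V)) :
    gadgetBase E = starBase none ((fun e => e.map Function.Embedding.some) '' E) := by
  rw [gadgetBase, starBase, Set.image_image]

theorem none_notMem_of_mem_image {V : Type*} {E : Set (Finset V)} :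
    ∀ e ∈ (fun e : Finset V => e.map Function.Embedding.some) '' E, none ∉ e := by
  rintro _ ⟨e, -, rfl⟩
  simp

/-- Sets avoiding `none` correspond to subsets of `V`, with the same inclusions and the same
independent sets. Degenerate hypergraphs need no exception here. -/
theorem irrAt_gadgetBase {V : Type*} [Fintype V] [DecidableEq V] (E : Set (Finset V)) :
    irrAt (closedSets (gadgetBase E)) none =
      (fun I => I.map Function.Embedding.some) '' MIS E := by
  have hmap : ∀ M : Finset (Option V), none ∉ M →
      M = M.eraseNone.map Function.Embedding.some := fun M h => by
    rw [Finset.map_some_eraseNone, Finset.erase_eq_of_notMem h]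
  have hindep : ∀ I : Finset V, (none ∉ I.map Function.Embedding.some ∧
      ∀ e ∈ (fun e : Finset V => e.map Function.Embedding.some) '' E,
        ¬ e ⊆ I.map Function.Embedding.some) ↔ ∀ e ∈ E, ¬ e ⊆ I := by
    intro I
    simp
  rw [gadgetBase_eq, irrAt_starBase]
  ext M
  rw [Set.mem_ofPred_eq]
  constructor
  · intro hM
    refine ⟨M.eraseNone, ?_, (hmap M hM.prop.1).symm⟩
    rw [mem_MIS]
    have h := hmap M hM.prop.1
    refine ⟨(hindep _).1 (h ▸ hM.prop), fun J hJ hle => ?_⟩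
    have := hM.le_of_ge ((hindep J).2 hJ) (by
      rw [h]
      exact Finset.map_subset_map.2 hle)
    rw [h] at this
    exact Finset.map_subset_map.1 this
  · rintro ⟨I, hI, rfl⟩
    rw [mem_MIS] at hI
    refine ⟨(hindep I).2 hI.prop, fun J hJ hle => ?_⟩
    have h := hmap J hJ.1
    rw [h] at hJ hle ⊢
    exact Finset.map_subset_map.2 (hI.le_of_ge ((hindep _).1 hJ) (Finset.map_subset_map.1 hle))

end Hypergraph

/-! ### Subsets of `Fin (n + 1)` -/

/-- The subset of `Fin (n + 1)` that contains `0` if and only if `b`, and the successors of the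
elements of `A`. -/
def consSet {n : ℕ} (b : Bool) (A : Finset (Fin n)) : Finset (Fin (n + 1)) :=
  Finset.univ.filter fun i => Fin.cases (motive := fun _ => Bool) b (fun j => decide (j ∈ A)) i = true

/-- The elements of `A` other than `0`, shifted down. -/
def tailSet {n : ℕ} (A : Finset (Fin (n + 1))) : Finset (Fin n) :=
  Finset.univ.filter fun i => i.succ ∈ A

section ConsSet

variable {n : ℕ}

@[simp] theorem zero_mem_consSet {b : Bool} {A : Finset (Fin n)} :
    0 ∈ consSet b A ↔ b = true := by
  simp [consSet]

@[simp] theorem succ_mem_consSet {b : Bool} {A : Finset (Fin n)} {i : Fin n} :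
    i.succ ∈ consSet b A ↔ i ∈ A := by
  simp [consSet]

@[simp] theorem one_mem_consSet {b : Bool} {A : Finset (Fin (n + 1))} :
    1 ∈ consSet b A ↔ 0 ∈ A :=
  succ_mem_consSet (i := 0)

@[simp] theorem mem_tailSet {A : Finset (Fin (n + 1))} {i : Fin n} :
    i ∈ tailSet A ↔ i.succ ∈ A := by
  simp [tailSet]

@[simp] theorem tailSet_consSet (b : Bool) (A : Finset (Fin n)) :
    tailSet (consSet b A) = A := by
  ext i
  simp

theorem consSet_tailSet (A : Finset (Fin (n + 1))) :
    consSet (decide (0 ∈ A)) (tailSet A) = A := by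
  ext i
  refine Fin.cases ?_ (fun i => ?_) i <;> simp

/-- Used three times, this exhibits the bits of the three added vertices, and claims about extended
sets reduce to cases on booleans. -/
theorem exists_consSet (A : Finset (Fin (n + 1))) : ∃ b B, A = consSet b B :=
  ⟨_, _, (consSet_tailSet A).symm⟩

@[simp] theorem consSet_inj {b b' : Bool} {A A' : Finset (Fin n)} :
    consSet b A = consSet b' A' ↔ b = b' ∧ A = A' := by
  refine ⟨fun h => ⟨?_, by simpa using congrArg tailSet h⟩, fun h => by rw [h.1, h.2]⟩
  rw [Bool.eq_iff_iff, ← zero_mem_consSet (b := b), h, zero_mem_consSet]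

@[simp] theorem consSet_subset {b b' : Bool} {A A' : Finset (Fin n)} :
    consSet b A ⊆ consSet b' A' ↔ (b = true → b' = true) ∧ A ⊆ A' := by
  constructor
  · exact fun h => ⟨fun hb => by simpa using h (zero_mem_consSet.2 hb),
      fun i hi => by simpa using h (succ_mem_consSet.2 hi)⟩
  · intro h i
    refine Fin.cases (by simpa using h.1) (fun i => ?_) i
    simpa using @h.2 i

theorem exists_mem_consSet {b b' : Bool} {A A' : Finset (Fin n)} :
    (∃ v ∈ consSet b A, v ∈ consSet b' A') ↔ (b = true ∧ b' = true) ∨ ∃ v ∈ A, v ∈ A' := by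
  simp [Fin.exists_fin_succ]

@[simp] theorem consSet_true_univ : consSet true (Finset.univ : Finset (Fin n)) = Finset.univ := by
  ext i
  refine Fin.cases ?_ (fun i => ?_) i <;> simp

@[simp] theorem consSet_false_empty : consSet false (∅ : Finset (Fin n)) = ∅ := by
  ext i
  refine Fin.cases ?_ (fun i => ?_) i <;> simp

theorem consSet_true_empty : consSet true (∅ : Finset (Fin n)) = {0} := by
  ext i
  refine Fin.cases ?_ (fun i => ?_) i <;> simp [Fin.ext_iff]

theorem univ_erase_zero : (Finset.univ : Finset (Fin (n + 1))).erase 0 =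
    consSet false Finset.univ := by
  ext i
  refine Fin.cases ?_ (fun i => ?_) i <;> simp

theorem univ_erase_succ (x : Fin n) : (Finset.univ : Finset (Fin (n + 1))).erase x.succ =
    consSet true (Finset.univ.erase x) := by
  ext i
  refine Fin.cases ?_ (fun i => ?_) i <;> simp [eq_comm, Fin.succ_ne_zero]

end ConsSet

/-! ### Extending a hypergraph by three vertices -/

/-- The hypergraph obtained by adding the vertices `0`, `1` and `2`, adding `1` to every edge, and
adding the edge `{2}`. -/
def extEdges {n : ℕ} (E : Set (Finset (Fin n))) : Set (Finset (Fin (n + 3))) :=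
  insert (consSet false (consSet false (consSet true ∅)))
    ((fun e => consSet false (consSet true (consSet false e))) '' E)

section ExtEdges

variable {n : ℕ} {E : Set (Finset (Fin n))}

theorem zero_notMem_extEdges : ∀ e ∈ extEdges E, 0 ∉ e := by
  rintro _ (rfl | ⟨e, -, rfl⟩) <;> simp

theorem extEdges_nonempty : (extEdges E).Nonempty := ⟨_, Set.mem_insert _ _⟩

/-- True even if `∅ ∈ E`, since every old edge receives the vertex `1`. -/
theorem empty_notMem_extEdges : ∅ ∉ extEdges E := by
  intro h
  simp [extEdges, ← consSet_false_empty] at h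

theorem indep_extEdges {a b c : Bool} {A : Finset (Fin n)} :
    (∀ e ∈ extEdges E, ¬ e ⊆ consSet a (consSet b (consSet c A))) ↔
      c = false ∧ (b = true → ∀ e ∈ E, ¬ e ⊆ A) := by
  simp only [extEdges, Set.forall_mem_insert, Set.forall_mem_image]
  cases b <;> cases c <;> simp

/-- The edge `{2}` excludes `2`. With `1` present, independence is that of `E`; without `1` no old
edge can be included, so all old vertices belong to the set. Hence only one possible set has to be
discarded. -/
theorem of_maximal_indep_extEdges {a b c : Bool} {A : Finset (Fin n)}
    (h : Maximal (fun M => 0 ∉ M ∧ ∀ e ∈ extEdges E, ¬ e ⊆ M)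
      (consSet a (consSet b (consSet c A)))) :
    a = false ∧ c = false ∧ (b = true → A ∈ MIS E) ∧ (b = false → A = Finset.univ) := by
  have ha : a = false := by simpa using h.prop.1
  subst ha
  obtain ⟨rfl, hb⟩ := indep_extEdges.1 h.prop.2
  refine ⟨rfl, rfl, ?_, ?_⟩
  · rintro rfl
    refine ⟨hb rfl, fun B hB hle => ?_⟩
    have := h.le_of_ge (y := consSet false (consSet true (consSet false B)))
      ⟨by simp, indep_extEdges.2 ⟨rfl, fun _ => hB⟩⟩ (by simpa using hle)
    simpa using this
  · rintro rfl
    have := h.le_of_ge (y := consSet false (consSet false (consSet false Finset.univ)))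
      ⟨by simp, indep_extEdges.2 ⟨rfl, by simp⟩⟩ (by simp)
    simpa [Finset.univ_subset_iff] using this

theorem maximal_indep_extEdges {A : Finset (Fin n)} (hA : A ∈ MIS E) :
    Maximal (fun M => 0 ∉ M ∧ ∀ e ∈ extEdges E, ¬ e ⊆ M)
      (consSet false (consSet true (consSet false A))) := by
  rw [mem_MIS] at hA
  refine ⟨⟨by simp, indep_extEdges.2 ⟨rfl, fun _ => hA.prop⟩⟩, fun M hM hle => ?_⟩
  obtain ⟨a, M, rfl⟩ := exists_consSet M
  obtain ⟨b, M, rfl⟩ := exists_consSet M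
  obtain ⟨c, M, rfl⟩ := exists_consSet M
  obtain ⟨rfl, h⟩ := indep_extEdges.1 hM.2
  simp at hle
  have := hA.le_of_ge (h hle.1) hle.2
  simpa [hle.1] using ⟨by simpa using hM.1, this⟩

theorem hitting_extEdges {a b c : Bool} {A : Finset (Fin n)} :
    (∀ e ∈ extEdges E, ∃ v ∈ consSet a (consSet b (consSet c A)), v ∈ e) ↔
      c = true ∧ (b = true ∨ ∀ e ∈ E, ∃ v ∈ A, v ∈ e) := by
  simp only [extEdges, Set.forall_mem_insert, Set.forall_mem_image, exists_mem_consSet]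
  cases b <;> cases c <;> simp

/-- The edge `{2}` forces `2`. Vertex `1` hits all other edges, so with it nothing more is needed;
without it the old vertices must hit `E`. The only possible set to discard is `{1, 2}`. -/
theorem of_minimal_hitting_extEdges {a b c : Bool} {A : Finset (Fin n)}
    (h : consSet a (consSet b (consSet c A)) ∈ MHS (extEdges E)) :
    a = false ∧ c = true ∧ (b = false → A ∈ MHS E) ∧ (b = true → A = ∅) := by
  rw [mem_MHS] at h
  obtain ⟨rfl, hb⟩ := hitting_extEdges.1 h.prop
  have ha := h.le_of_le (y := consSet false (consSet b (consSet true A)))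
    (hitting_extEdges.2 ⟨rfl, hb⟩) (by simp)
  have ha : a = false := by simpa using ha
  subst ha
  refine ⟨rfl, rfl, ?_, ?_⟩
  · rintro rfl
    refine ⟨by simpa using hb, fun B hB hle => ?_⟩
    have := h.le_of_le (y := consSet false (consSet false (consSet true B)))
      (hitting_extEdges.2 ⟨rfl, .inr hB⟩) (by simpa using hle)
    simpa using this
  · rintro rfl
    have := h.le_of_le (y := consSet false (consSet true (consSet true ∅)))
      (hitting_extEdges.2 ⟨rfl, .inl rfl⟩) (by simp)
    simpa [Finset.subset_empty] using this

theorem minimal_hitting_extEdges {A : Finset (Fin n)} (hA : A ∈ MHS E) :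
    consSet false (consSet false (consSet true A)) ∈ MHS (extEdges E) := by
  rw [mem_MHS] at hA ⊢
  refine ⟨hitting_extEdges.2 ⟨rfl, .inr hA.prop⟩, fun M hM hle => ?_⟩
  obtain ⟨a, M, rfl⟩ := exists_consSet M
  obtain ⟨b, M, rfl⟩ := exists_consSet M
  obtain ⟨c, M, rfl⟩ := exists_consSet M
  obtain ⟨rfl, h⟩ := hitting_extEdges.1 hM
  simp at hle
  obtain ⟨rfl, rfl, hle⟩ := hle
  have := hA.le_of_le (by simpa using h) hle
  simpa using this

/-- `{2}` is incomparable with the other edges, which contain `1` and not `2`, so minimality is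
decided within `E`. -/
theorem minimal_mem_extEdges {M : Finset (Fin (n + 3))} :
    Minimal (· ∈ extEdges E) M ↔ M = consSet false (consSet false (consSet true ∅)) ∨
      ∃ e, Minimal (· ∈ E) e ∧ M = consSet false (consSet true (consSet false e)) := by
  constructor
  · intro h
    rcases h.prop with rfl | ⟨e, he, rfl⟩
    · exact .inl rfl
    · refine .inr ⟨e, ⟨he, fun e' he' hle => ?_⟩, rfl⟩
      have := h.le_of_le (y := consSet false (consSet true (consSet false e')))
        (.inr ⟨e', he', rfl⟩) (by simpa using hle)
      simpa using this
  · rintro (rfl | ⟨e, he, rfl⟩)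
    · refine ⟨.inl rfl, ?_⟩
      rintro _ (rfl | ⟨e, -, rfl⟩) hle
      · exact hle
      · simp at hle
    · refine ⟨.inr ⟨e, he.prop, rfl⟩, ?_⟩
      rintro _ (rfl | ⟨e', he', rfl⟩) hle
      · simp at hle
      · simpa using he.le_of_le he' (by simpa using hle)

end ExtEdges

/-! ### The closure system of the minimal hitting sets -/

section HittingSystem

variable {α : Type*} {z : α} {E : Set (Finset α)}

theorem notMem_of_mem_MHS [DecidableEq α] (hz : ∀ e ∈ E, z ∉ e) : ∀ T ∈ MHS E, z ∉ T := by
  intro T hT h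
  rw [mem_MHS] at hT
  have := hT.le_of_le (y := T.erase z) (fun e he => by
    obtain ⟨v, hv, hve⟩ := hT.prop e he
    exact ⟨v, Finset.mem_erase.2 ⟨fun h => hz e he (h ▸ hve), hv⟩, hve⟩) (Finset.erase_subset _ _)
  exact Finset.notMem_erase z T (this h)

theorem exists_MHS_subset {T : Finset α} (hT : ∀ e ∈ E, ∃ v ∈ T, v ∈ e) :
    ∃ T' ∈ MHS E, T' ⊆ T := by
  obtain ⟨T', h, h'⟩ := exists_minimal_le_of_wellFoundedLT
    (fun T : Finset α => ∀ e ∈ E, ∃ v ∈ T, v ∈ e) T hT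
  exact ⟨T', h', h⟩

theorem empty_notMem_MHS (hE : E.Nonempty) : ∅ ∉ MHS E := by
  intro h
  rw [mem_MHS] at h
  obtain ⟨e, he⟩ := hE
  simpa using h.prop e he

theorem MHS_nonempty [Fintype α] (hE : ∅ ∉ E) : (MHS E).Nonempty := by
  obtain ⟨T, hT, -⟩ := exists_MHS_subset (E := E) (T := Finset.univ) (fun e he => by
    obtain ⟨v, hv⟩ := Finset.nonempty_iff_ne_empty.2 fun h => hE (h ▸ he)
    exact ⟨v, Finset.mem_univ v, hv⟩)
  exact ⟨T, hT⟩

/-- Hypergraph duality: a set includes no minimal hitting set iff it is not a hitting set, that is,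
iff it misses some edge. The maximal sets of this kind without `z` come from the minimal edges. -/
theorem irrAt_hittingSystem [Fintype α] [DecidableEq α] (hz : ∀ e ∈ E, z ∉ e) :
    irrAt (closedSets (starBase z (MHS E))) z =
      {M | ∃ e, Minimal (· ∈ E) e ∧ M = (insert z e)ᶜ} := by
  have hP : (fun M : Finset α => z ∉ M ∧ ∀ T ∈ MHS E, ¬ T ⊆ M) =
      fun M => ∃ e ∈ E, M ⊆ (insert z e)ᶜ := by
    funext M
    refine propext ⟨fun ⟨hM, h⟩ => ?_, fun ⟨e, he, h⟩ => ?_⟩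
    · by_contra! hall
      obtain ⟨T, hT, hTM⟩ := exists_MHS_subset (E := E) (T := M) (fun e he => by
        obtain ⟨v, hv, hve⟩ := Finset.not_subset.1 (hall e he)
        rw [Finset.mem_compl, not_not, Finset.mem_insert] at hve
        exact ⟨v, hv, hve.resolve_left fun h => hM (h ▸ hv)⟩)
      exact h T hT hTM
    · refine ⟨fun hM => by simpa using h hM, fun T hT hTM => ?_⟩
      rw [mem_MHS] at hT
      obtain ⟨v, hv, hve⟩ := hT.prop e he
      exact Finset.mem_compl.1 (h (hTM hv)) (Finset.mem_insert_of_mem hve)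
  have hins : ∀ e ∈ E, ∀ e' : Finset α, (insert z e')ᶜ ⊆ (insert z e)ᶜ ↔ e ⊆ e' := by
    intro e he e'
    rw [Finset.compl_subset_compl]
    exact ⟨fun h => (Finset.insert_subset_insert_iff (hz e he)).1 h,
      fun h => Finset.insert_subset_insert z h⟩
  rw [irrAt_starBase, hP]
  ext M
  rw [Set.mem_ofPred_eq, Set.mem_ofPred_eq]
  constructor
  · intro hM
    obtain ⟨e, he, hMe⟩ := hM.prop
    obtain rfl := hM.eq_of_le ⟨e, he, subset_rfl⟩ hMe
    exact ⟨e, ⟨he, fun e' he' hle => (hins e he e').1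
      (hM.le_of_ge ⟨e', he', subset_rfl⟩ ((hins e' he' e).2 hle))⟩, rfl⟩
  · rintro ⟨e, he, rfl⟩
    refine ⟨⟨e, he.prop, subset_rfl⟩, ?_⟩
    rintro M ⟨e', he', hM⟩ hle
    have h1 := he.le_of_le he' ((hins e' he' e).1 (hle.trans hM))
    exact hM.trans ((hins e he.prop e').2 h1)

end HittingSystem

/-! ### Polynomial-time functions on lists and characteristic vectors -/

theorem Data.size_pos (d : Data) : 0 < d.size := by
  cases d with
  | nil => exact one_pos
  | cons a b => rw [Data.size_cons]; omega

/-- The tree `cons nil nil`, which codes `true`. -/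
abbrev Data.one : Data := .cons .nil .nil

/-- The truth value coded by a tree. -/
def Data.toBool : Data → Bool
  | .nil => false
  | .cons _ _ => true

@[simp] theorem Data.toBool_ofBool (b : Bool) : (Data.ofBool b).toBool = b := by
  cases b <;> rfl

theorem Data.cond_eq_ite (d x y : Data) : d.cond x y = if d.toBool then x else y := by
  cases d <;> rfl

namespace Polytime

variable {f g h : Data → Data}

theorem reverse (hg : Polytime g) : Polytime fun d => Data.ofList (g d).toList.reverse := by
  have h := fold_of_add (f := fun e => .cons e.tl.hd e.hd) (g := g) (h := fun _ => .nil)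
    (Polytime.id.tl.hd.cons Polytime.id.hd) hg .nil (w := fun e => 1 + e.size)
    ((PolyBounded.const _ _).add (.self _)) (fun a x d => by
      simp only [Data.size_cons, Data.hd_cons, Data.tl_cons]; omega)
  have key : ∀ d l a, foldData (fun e => .cons e.tl.hd e.hd) d l a =
      Data.ofList (l.reverse ++ a.toList) := by
    intro d l
    induction l with
    | nil => simp
    | cons x l ih => intro a; simp [ih]
  simpa [key] using h

/-- A right fold is a left fold along the reversed list; it builds lists in the given order. -/
theorem foldr_of_add (hf : Polytime f) (hg : Polytime g) (hh : Polytime h) {w : Data → ℕ}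
    (hw : PolyBounded Data.size w)
    (hb : ∀ a x d, (f (.cons a (.cons x d))).size ≤ a.size + w (.cons x d)) :
    Polytime fun d => (g d).toList.foldr (fun x acc => f (.cons acc (.cons x d))) (h d) := by
  have := fold_of_add hf hg.reverse hh hw hb
  simpa [foldData] using this

theorem map (hf : Polytime f) (hg : Polytime g) :
    Polytime fun d => Data.ofList ((g d).toList.map fun x => f (.cons x d)) := by
  have h := foldr_of_add (f := fun e => .cons (f e.tl) e.hd) (g := g) (h := fun _ => .nil)
    ((hf.comp Polytime.id.tl).cons Polytime.id.hd) hg .nil (w := fun e => 1 + (f e).size)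
    ((PolyBounded.const _ _).add hf.size_bounded) (fun a x d => by
      simp only [Data.size_cons, Data.hd_cons, Data.tl_cons]; omega)
  have key : ∀ (d : Data) (l : List Data), l.foldr (fun x acc => Data.cons (f (Data.cons acc (.cons x d)).tl)
      (Data.cons acc (.cons x d)).hd) .nil = Data.ofList (l.map fun x => f (.cons x d)) := by
    intro d l
    induction l with
    | nil => rfl
    | cons x l ih => rw [List.foldr_cons, ih]; simp
  simpa only [key] using h

theorem append (hf : Polytime f) (hg : Polytime g) :
    Polytime fun d => Data.ofList ((f d).toList ++ (g d).toList) := by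
  have h := foldr_of_add (f := fun e => .cons e.tl.hd e.hd) (g := f) (h := g)
    (Polytime.id.tl.hd.cons Polytime.id.hd) hf hg (w := fun e => 1 + e.size)
    ((PolyBounded.const _ _).add (.self _)) (fun a x d => by
      simp only [Data.size_cons, Data.hd_cons, Data.tl_cons]; omega)
  have key : ∀ (d : Data) (l : List Data) (a : Data),
      l.foldr (fun x acc => Data.cons (Data.cons acc (.cons x d)).tl.hd
      (Data.cons acc (.cons x d)).hd) a = Data.ofList (l ++ a.toList) := by
    intro d l a
    induction l with
    | nil => simp
    | cons x l ih => rw [List.foldr_cons, ih]; simp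
  simpa only [key] using h

theorem filter (hg : Polytime g) (hf : Polytime f) :
    Polytime fun d => Data.ofList ((g d).toList.filter fun x => (f (.cons x d)).toBool) := by
  have h := foldr_of_add (f := fun e => .cond (f e.tl) (.cons e.tl.hd e.hd) e.hd) (g := g)
    (h := fun _ => .nil)
    ((hf.comp Polytime.id.tl).cond (Polytime.id.tl.hd.cons Polytime.id.hd) Polytime.id.hd) hg .nil
    (w := fun e => 1 + e.size)
    ((PolyBounded.const _ _).add (.self _)) (fun a x d => by
      simp only [Data.size_cons, Data.hd_cons, Data.tl_cons, Data.cond_eq_ite]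
      split_ifs
      · rw [Data.size_cons]; omega
      · omega)
  have key : ∀ (d : Data) (l : List Data), l.foldr (fun x acc => Data.cond (f (Data.cons acc (.cons x d)).tl)
      (.cons (Data.cons acc (.cons x d)).tl.hd (Data.cons acc (.cons x d)).hd)
      (Data.cons acc (.cons x d)).hd) .nil = Data.ofList (l.filter fun x => (f (.cons x d)).toBool) := by
    intro d l
    induction l with
    | nil => rfl
    | cons x l ih =>
      rw [List.foldr_cons, ih]
      simp only [Data.hd_cons, Data.tl_cons, Data.cond_eq_ite, List.filter_cons]
      split_ifs <;> rfl
  simpa only [key] using h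

theorem one : Polytime fun _ => Data.one := Polytime.nil.cons .nil

theorem all (hg : Polytime g) (hf : Polytime f) :
    Polytime fun d => Data.ofBool ((g d).toList.all fun x => (f (.cons x d)).toBool) := by
  have h := foldr_of_add (f := fun e => .cond (f e.tl) e.hd .nil) (g := g)
    (h := fun _ => .one)
    ((hf.comp Polytime.id.tl).cond Polytime.id.hd .nil) hg .one (w := fun _ => 0)
    (PolyBounded.const _ _) (fun a x d => by
      have := a.size_pos
      simp only [Data.hd_cons, Data.tl_cons, Data.cond_eq_ite]
      split_ifs
      · omega
      · rw [Data.size_nil]; omega)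
  have key : ∀ (d : Data) (l : List Data), l.foldr (fun x acc => Data.cond (f (Data.cons acc (.cons x d)).tl)
      (Data.cons acc (.cons x d)).hd .nil) .one = Data.ofBool (l.all fun x => (f (.cons x d)).toBool) := by
    intro d l
    induction l with
    | nil => rfl
    | cons x l ih =>
      rw [List.foldr_cons, ih]
      simp only [Data.hd_cons, Data.tl_cons, Data.cond_eq_ite, List.all_cons]
      cases (f (.cons x d)).toBool <;> rfl
  simpa only [key] using h

end Polytime

namespace Data

/-- Complement a characteristic vector. -/
def compl (d : Data) : Data := ofList (d.toList.map fun x => cond x nil one)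

/-- One step of the comparison of two characteristic vectors. -/
def subsetStep (e : Data) : Data :=
  cons e.hd.hd.tl (cond e.tl.hd (cond e.hd.hd.hd e.hd.tl nil) e.hd.tl)

/-- For the characteristic vectors of two sets `A` and `B`, whether `A ⊆ B`. -/
def subset (a b : Data) : Data :=
  (foldData subsetStep (cons a b) a.toList (cons b one)).tl

/-- Add one coordinate to the list of complements of singletons; the accumulator also contains the
characteristic vector of the whole set. -/
def coatomStep (e : Data) : Data :=
  cons (cons one e.hd.hd)
    (cons (cons nil e.hd.hd) (ofList (e.hd.tl.toList.map fun x => cons one x)))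

/-- The complements of the singletons of a set with as many elements as the list `d`. -/
def coatoms (d : Data) : Data := (foldData coatomStep d d.toList (cons nil nil)).tl

end Data

/-- The complements of singletons. -/
def coatomList : (n : ℕ) → List (Finset (Fin n))
  | 0 => []
  | n + 1 => consSet false Finset.univ :: (coatomList n).map (consSet true)

theorem mem_coatomList {n : ℕ} {M : Finset (Fin n)} :
    M ∈ coatomList n ↔ ∃ x, M = Finset.univ.erase x := by
  induction n with
  | zero => simp [coatomList]
  | succ n ih =>
    simp only [coatomList, List.mem_cons, List.mem_map, ih, Fin.exists_fin_succ, univ_erase_zero,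
      univ_erase_succ]
    refine or_congr_right ⟨?_, ?_⟩
    · rintro ⟨_, ⟨x, rfl⟩, rfl⟩
      exact ⟨x, rfl⟩
    · rintro ⟨x, rfl⟩
      exact ⟨_, ⟨x, rfl⟩, rfl⟩

theorem nodup_coatomList (n : ℕ) : (coatomList n).Nodup := by
  induction n with
  | zero => exact List.nodup_nil
  | succ n ih =>
    refine List.nodup_cons.2 ⟨by simp, ih.map fun A B h => by simpa using h⟩

theorem length_coatomList (n : ℕ) : (coatomList n).length = n := by
  induction n with
  | zero => rfl
  | succ n ih => simp [coatomList, ih]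

section Codes

open Data

variable {n : ℕ}

@[simp] theorem ofFinset_consSet (b : Bool) (A : Finset (Fin n)) :
    ofFinset (consSet b A) = cons (ofBool b) (ofFinset A) := by
  simp only [ofFinset, List.finRange_succ, List.map_cons, List.map_map, ofList_cons,
    zero_mem_consSet, Bool.decide_eq_true]
  congr 3
  funext i
  simp

theorem ofNat_succ (n : ℕ) : ofNat (n + 1) = cons nil (ofNat n) := rfl

/-- `false` is coded by `nil`, so a number in unary is already the characteristic vector of the
empty set. -/
theorem ofFinset_empty (n : ℕ) : ofFinset (∅ : Finset (Fin n)) = ofNat n := by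
  induction n with
  | zero => rfl
  | succ n ih => rw [← consSet_false_empty, ofFinset_consSet, ih]; rfl

theorem size_ofFinset_le (A : Finset (Fin n)) : (ofFinset A).size ≤ n * 4 + 1 := by
  have := size_ofList_le (l := (List.finRange n).map fun i => ofBool (decide (i ∈ A))) (B := 3)
    (by simp only [List.mem_map]; rintro _ ⟨i, -, rfl⟩; exact size_ofBool_le _)
  simpa [ofFinset] using this

theorem compl_ofFinset (A : Finset (Fin n)) : (ofFinset A).compl = ofFinset Aᶜ := by
  simp only [Data.compl, ofFinset, toList_ofList, List.map_map]
  congr 1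
  refine List.map_congr_left fun i _ => ?_
  by_cases h : i ∈ A <;> simp [h, ofBool]

theorem subset_ofFinset (A B : Finset (Fin n)) :
    (ofFinset A).subset (ofFinset B) = ofBool (decide (A ⊆ B)) := by
  -- The accumulator pairs the unread part of the second vector with the verdict so far.
  have key : ∀ (l : List (Fin n)) (env : Data) (b : Bool),
      foldData subsetStep env (l.map fun i => ofBool (decide (i ∈ A)))
        (cons (ofList (l.map fun i => ofBool (decide (i ∈ B)))) (ofBool b)) =
      cons nil (ofBool (b && l.all fun i => decide (i ∈ A → i ∈ B))) := by
    intro l env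
    induction l with
    | nil => simp
    | cons i l ih =>
      intro b
      have : subsetStep (cons (cons (ofList ((i :: l).map fun i => ofBool (decide (i ∈ B))))
          (ofBool b)) (cons (ofBool (decide (i ∈ A))) env)) =
          cons (ofList (l.map fun i => ofBool (decide (i ∈ B))))
            (ofBool (b && decide (i ∈ A → i ∈ B))) := by
        by_cases hA : i ∈ A <;> by_cases hB : i ∈ B <;> simp [subsetStep, hA, hB, ofBool]
      rw [List.map_cons, foldData_cons, this, ih]
      simp [Bool.and_assoc]
  rw [subset, ofFinset, toList_ofList]
  refine (congrArg tl (key _ _ true)).trans ?_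
  rw [tl_cons, Bool.true_and]
  congr 1
  rw [Bool.eq_iff_iff]
  simp [Finset.subset_iff, imp_iff_not_or]

/-- Only the length of `l` matters. The full vector is carried along because the new coatom omits
the new coordinate and contains all old ones. -/
theorem foldData_coatomStep (env : Data) (l : List Data) :
    foldData coatomStep env l (cons nil nil) =
      cons (ofFinset (Finset.univ : Finset (Fin l.length)))
        (ofList ((coatomList l.length).map ofFinset)) := by
  induction l using List.reverseRecOn with
  | nil => rfl
  | append_singleton l x ih =>
    have : foldData coatomStep env (l ++ [x]) (cons nil nil) =
        coatomStep (cons (foldData coatomStep env l (cons nil nil)) (cons x env)) := by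
      simp [foldData]
    rw [this, ih]
    -- The length is generalized to `k` because the types of the sets depend on it.
    have h : ∀ k, k = l.length + 1 → coatomStep (cons (cons
        (ofFinset (Finset.univ : Finset (Fin l.length)))
        (ofList ((coatomList l.length).map ofFinset))) (cons x env)) =
        cons (ofFinset (Finset.univ : Finset (Fin k))) (ofList ((coatomList k).map ofFinset)) := by
      rintro _ rfl
      rw [← consSet_true_univ]
      simp [coatomStep, coatomList, ofBool, Function.comp_def, -consSet_true_univ]
    exact h _ (by simp)

theorem coatoms_ofNat (n : ℕ) : coatoms (ofNat n) = ofList ((coatomList n).map ofFinset) := by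
  rw [coatoms, foldData_coatomStep, tl_cons, ofNat, toList_ofList, List.length_replicate]

theorem size_familyCode_le (n : ℕ) (F : List (Finset (Fin n))) :
    (familyCode n F).size ≤ 1 + (n * 2 + 1) + (F.length * (n * 4 + 2) + 1) := by
  have h1 := size_ofList_le (l := List.replicate n nil) (B := 1) (by
    intro x hx
    rw [List.eq_of_mem_replicate hx, size_nil])
  have h2 := size_ofList_le (l := F.map ofFinset) (B := n * 4 + 1) (by
    simp only [List.mem_map]
    rintro _ ⟨A, -, rfl⟩
    exact size_ofFinset_le A)
  rw [List.length_replicate] at h1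
  rw [List.length_map, show n * 4 + 1 + 1 = n * 4 + 2 from rfl] at h2
  simp only [familyCode, size_cons, ofNat]
  omega

end Codes

namespace Polytime

variable {f g : Data → Data}

theorem compl (hg : Polytime g) : Polytime fun d => (g d).compl :=
  map (f := fun e => .cond e.hd .nil .one) (Polytime.id.hd.cond .nil .one) hg

theorem subset (hf : Polytime f) (hg : Polytime g) : Polytime fun d => (f d).subset (g d) := by
  refine comp (f := fun d => d.hd.subset d.tl) ?_ (hf.cons hg)
  have h : Polytime Data.subsetStep :=
    Polytime.id.hd.hd.tl.cons (Polytime.id.tl.hd.cond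
      (Polytime.id.hd.hd.hd.cond Polytime.id.hd.tl .nil) Polytime.id.hd.tl)
  -- The growth bound must hold for malformed accumulators too: `nil`, of size 1, becomes a pair of
  -- size 3, hence the `2`.
  have h' := (fold_of_add h Polytime.id.hd (Polytime.id.tl.cons .one) (w := fun _ => 2)
    (PolyBounded.const _ _) (fun a x d => by
      have h1 := Data.size_tl_le a.hd
      have h2 := a.tl.size_pos
      have h3 : a.hd.size + a.tl.size ≤ a.size + 1 := by
        cases a with
        | nil => simp
        | cons b c => simp; omega
      simp only [Data.subsetStep, Data.hd_cons, Data.tl_cons, Data.size_cons]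
      cases x <;> cases a.hd.hd <;> simp <;> omega)).tl
  -- The step ignores the environment, so the one supplied by the fold may differ from the one in
  -- `Data.subset`.
  have key : ∀ (d e e' : Data) (l : List Data) (a : Data),
      foldData Data.subsetStep e l a = foldData Data.subsetStep e' l a := by
    intro d e e' l
    induction l with
    | nil => exact fun _ => rfl
    | cons x l ih => exact fun a => ih _
  have : (fun d : Data => d.hd.subset d.tl) = fun d : Data =>
      (foldData Data.subsetStep d d.hd.toList (.cons d.tl .one)).tl := by
    funext d
    rw [Data.subset, key d _ d]
  rwa [this]

theorem coatoms (hg : Polytime g) : Polytime fun d => (g d).coatoms := by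
  refine comp (f := fun d => d.coatoms) ?_ hg
  have h : Polytime Data.coatomStep :=
    (one.cons Polytime.id.hd.hd).cons ((Polytime.nil.cons Polytime.id.hd.hd).cons
      (map (f := fun e => .cons .one e.hd) (one.cons Polytime.id.hd) Polytime.id.hd.tl))
  -- Each step lengthens every vector in the list, so the growth depends on the accumulator and
  -- `fold_of_add` does not apply. The size bound comes from the exact value in
  -- `foldData_coatomStep`.
  refine (fold h .id (Polytime.nil.cons .nil)
    (q := fun d => 1 + (d.size * 4 + 1) + (d.size * (d.size * 4 + 2) + 1)) ?_ ?_).tl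
  · have hs := PolyBounded.self Data.size
    exact (((PolyBounded.const _ 1).add ((hs.mul (.const _ 4)).add (.const _ 1)))).add
      ((hs.mul ((hs.mul (.const _ 4)).add (.const _ 2))).add (.const _ 1))
  · intro d l₁ l₂ hl
    have hlen : l₁.length ≤ d.size := by
      have := Data.length_toList_le d
      rw [hl, List.length_append] at this
      omega
    rw [foldData_coatomStep, Data.size_cons]
    have h1 := size_ofFinset_le (Finset.univ : Finset (Fin l₁.length))
    have h2 := Data.size_ofList_le (l := (coatomList l₁.length).map Data.ofFinset)
      (B := l₁.length * 4 + 1) (by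
        simp only [List.mem_map]
        rintro _ ⟨A, -, rfl⟩
        exact size_ofFinset_le A)
    rw [List.length_map, length_coatomList] at h2
    have h3 : l₁.length * (l₁.length * 4 + 1 + 1) ≤ d.size * (d.size * 4 + 2) :=
      Nat.mul_le_mul hlen (by omega)
    omega

end Polytime

open EnumProblem

/-! ### Complementing the items -/

/-- Enumerate a family of vertex sets of a hypergraph. -/
def hypergraphEnum (A : (H : HypergraphInst) → Set (Finset (Fin H.n))) : EnumProblem where
  Inst := HypergraphInst
  size H := H.n + H.edges.length
  code H := familyCode H.n H.edges
  Item H := Finset (Fin H.n)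
  itemCode _ I := Data.ofFinset I
  IsAnswer H S := S = A H

/-- The instances are the same and complementation is a bijection on items, so it suffices to
complement what the decoder accepts. Rejections are unaffected. -/
theorem PolyReduction.compl {A A' : (H : HypergraphInst) → Set (Finset (Fin H.n))}
    (hA : ∀ H I, Iᶜ ∈ A' H ↔ I ∈ A H) {P : EnumProblem}
    (R : PolyReduction (hypergraphEnum A) P) : PolyReduction (hypergraphEnum A') P := by
  obtain ⟨f, g, cf, cg, p, h1, h2, h3, h4⟩ := R
  obtain ⟨c, k, T, -, ⟨q, hT⟩, -, hc⟩ : Polytime fun d => d.cond (.cons .nil d.tl.compl) .nil :=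
    Polytime.id.cond (Polytime.nil.cons Polytime.id.tl.compl) .nil
  refine ⟨f, fun (i : HypergraphInst) x =>
      Option.map (fun I : Finset (Fin i.n) => (Iᶜ : Finset (Fin i.n))) (g i x), cf, .seq cg.subroutine c,
    -- An accepted set has a code of size at most `4 * n + 1`, and the tag of `Data.ofOption` adds
    -- 2.
    p + (.C (cg.bound + 1) + q.comp (.C 4 * .X + .C 3)), fun i => ?_, fun i => ?_, fun i x => ?_,
    fun i S hS => ⟨?_, ?_, ?_⟩⟩
  · rw [Polynomial.eval_add]
    exact (h1 i).trans (Nat.le_add_right _ _)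
  · obtain ⟨t, s, x, v, b⟩ := h2 i
    rw [Polynomial.eval_add]
    exact ⟨t, s, x, v, b.trans (Nat.le_add_right _ _)⟩
  · obtain ⟨t, s, x', v, b⟩ := h3 i x
    obtain ⟨a, σ, r1, v1, -, b1⟩ := call_subroutine x' (initStore _) (by simp [initStore]; rfl)
    obtain ⟨a', σ', r2, v2, -, b2⟩ := hc _ σ v1
    refine ⟨_, σ', r1.seq r2, ?_, ?_⟩
    · have ho : ∀ o : Option (Finset (Fin i.n)),
          (Data.ofOption (o.map Data.ofFinset)).cond
            (.cons .nil (Data.ofOption (o.map Data.ofFinset)).tl.compl) .nil =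
          Data.ofOption ((o.map fun I => Iᶜ).map Data.ofFinset) := by
        rintro (_ | I)
        · rfl
        · simp [Data.ofOption, compl_ofFinset]
      rw [v] at v2
      exact v2.trans (ho (g i x))
    · have hs : (s 0).size ≤ 4 * (i.n + i.edges.length) + 3 := by
        rw [v]
        cases g i x with
        | none => simp [Data.ofOption]
        | some I =>
          have := size_ofFinset_le (n := i.n) I
          simp only [Option.map_some, Data.ofOption, Data.size_cons, Data.size_nil]
          change 1 + 1 + (Data.ofFinset (n := i.n) I).size ≤ _
          omega
      have := (b2.trans (hT _)).trans (eval_mono q hs)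
      simp only [hypergraphEnum, List.length_replicate, Polynomial.eval_add, Polynomial.eval_C,
        Polynomial.eval_comp, Polynomial.eval_mul, Polynomial.eval_X] at this b ⊢
      omega
  · have h : {y | ∃ x ∈ S, g i x = some y} = A i := (h4 i S hS).1
    refine Set.ext fun (y : Finset (Fin i.n)) => ?_
    have hy := hA i yᶜ
    rw [compl_compl, ← h] at hy
    refine Iff.trans ?_ hy.symm
    constructor
    · rintro ⟨x, hx, hy⟩
      obtain ⟨I, hI, e⟩ := Option.map_eq_some_iff.1 hy
      obtain rfl : Iᶜ = y := e
      exact ⟨x, hx, by rw [compl_compl]; exact hI⟩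
    · rintro ⟨x, hx, hy⟩
      exact ⟨x, hx, Option.map_eq_some_iff.2 ⟨_, hy, compl_compl y⟩⟩
  · intro x hx x' hx' y hy hy'
    obtain ⟨I, hI, rfl⟩ := Option.map_eq_some_iff.1 hy
    obtain ⟨J, hJ, hJI⟩ := Option.map_eq_some_iff.1 hy'
    obtain rfl := compl_injective (α := Finset (Fin i.n)) hJI
    exact (h4 i S hS).2.1 x hx x' hx' _ hI hJ
  · have h : {x | x ∈ S ∧ Option.map (fun I : Finset (Fin i.n) => (Iᶜ : Finset (Fin i.n)))
        (g i x) = none} ⊆ {x ∈ S | g i x = none} :=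
      fun x hx => ⟨hx.1, Option.map_eq_none_iff.1 hx.2⟩
    refine ((Set.encard_le_encard h).trans (h4 i S hS).2.2).trans (Nat.cast_le.2 ?_)
    rw [Polynomial.eval_add]
    exact Nat.le_add_right _ _

theorem polyReduction_MHSEnum {P : EnumProblem} (R : PolyReduction MISEnum P) :
    PolyReduction MHSEnum P :=
  PolyReduction.compl (A := fun H => MIS {e | e ∈ H.edges}) (A' := fun H => MHS {e | e ∈ H.edges})
    (fun _ _ => compl_mem_MHS) R

theorem polyReduction_MISEnum {P : EnumProblem} (R : PolyReduction MHSEnum P) :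
    PolyReduction MISEnum P :=
  PolyReduction.compl (A := fun H => MHS {e | e ∈ H.edges}) (A' := fun H => MIS {e | e ∈ H.edges})
    (fun _ I => by rw [← compl_mem_MHS, compl_compl]) R

/-! ### Enumerating irreducible closed sets -/

/-- The sizes of the codes of hypergraphs. -/
theorem polyBounded_familyCode :
    PolyBounded (fun H : HypergraphInst => H.n + H.edges.length)
      fun H => (familyCode H.n H.edges).size := by
  have hs := PolyBounded.self fun H : HypergraphInst => H.n + H.edges.length
  have h1 : PolyBounded (fun H : HypergraphInst => H.n + H.edges.length) fun H => H.n :=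
    hs.mono fun H => Nat.le_add_right _ _
  have h2 : PolyBounded (fun H : HypergraphInst => H.n + H.edges.length) fun H => H.edges.length :=
    hs.mono fun H => Nat.le_add_left _ _
  exact ((((PolyBounded.const _ 1).add ((h1.mul (.const _ 2)).add (.const _ 1)))).add
    ((h2.mul ((h1.mul (.const _ 4)).add (.const _ 2))).add (.const _ 1))).mono
    fun H => size_familyCode_le _ _

theorem polyBounded_ofFinset {β : HypergraphInst → Type} (n : HypergraphInst → ℕ) {k : ℕ}
    (hn : ∀ H, n H ≤ H.n + k)
    (A : (H : HypergraphInst) → β H → Finset (Fin (n H))) :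
    PolyBounded (fun Hx : (H : HypergraphInst) × β H => Hx.1.n + Hx.1.edges.length)
      fun Hx => (Data.ofFinset (A Hx.1 Hx.2)).size := by
  refine (((PolyBounded.self _).mul (.const _ 4)).add (.const _ (k * 4 + 1))).mono fun Hx => ?_
  have := hn Hx.1
  have := size_ofFinset_le (A Hx.1 Hx.2)
  omega

/-- The edges of the extended hypergraph. -/
def HypergraphInst.ext (H : HypergraphInst) : List (Finset (Fin (H.n + 3))) :=
  consSet false (consSet false (consSet true ∅)) ::
    H.edges.map fun e => consSet false (consSet true (consSet false e))

theorem HypergraphInst.mem_ext (H : HypergraphInst) :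
    {e | e ∈ H.ext} = extEdges {e | e ∈ H.edges} := by
  ext e
  simp [HypergraphInst.ext, extEdges]

theorem HypergraphInst.nodup_ext (H : HypergraphInst) : H.ext.Nodup :=
  List.nodup_cons.2 ⟨by simp, H.nodup.map fun e e' h => by simpa using h⟩

theorem HypergraphInst.mem_map_ext (H : HypergraphInst) :
    {i | i ∈ H.ext.map fun e => (⟨e, {0}⟩ : Implication (Fin (H.n + 3)))} =
      starBase 0 (extEdges {e | e ∈ H.edges}) := by
  rw [← H.mem_ext, starBase]
  exact Set.ext fun i => List.mem_map

/-- The implicational base `{e → 0 : e an edge of the extended hypergraph}`. -/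
def HypergraphInst.toBase {K : BaseClass}
    (hK : ∀ (n : ℕ) (B : Set (Implication (Fin n))), IsHeightTwoBase B → K n B)
    (H : HypergraphInst) : BaseInst K where
  n := H.n + 3
  imps := H.ext.map fun e => ⟨e, {0}⟩
  nodup := H.nodup_ext.map fun e e' h => by simpa using h
  mem := by
    rw [H.mem_map_ext]
    exact hK _ _ (isHeightTwoBase_starBase zero_notMem_extEdges extEdges_nonempty
      empty_notMem_extEdges)

theorem HypergraphInst.system_toBase {K : BaseClass}
    (hK : ∀ (n : ℕ) (B : Set (Implication (Fin n))), IsHeightTwoBase B → K n B)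
    (H : HypergraphInst) : (H.toBase hK).system =
      closedSets (starBase (0 : Fin (H.n + 3)) (extEdges {e | e ∈ H.edges})) :=
  congrArg closedSets H.mem_map_ext

/-- The code of `H.toBase` as a function of the code of `H`. -/
def baseData (d : Data) : Data :=
  .cons (.cons .nil (.cons .nil (.cons .nil d.hd)))
    (.cons (.cons (.cons .nil (.cons .nil (.cons .one d.hd)))
        (.cons .one (.cons .nil (.cons .nil d.hd))))
      (.ofList (d.tl.toList.map fun x => .cons (.cons .nil (.cons .one (.cons .nil x)))
        (.cons .one (.cons .nil (.cons .nil d.hd))))))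

theorem polytime_baseData : Polytime baseData := by
  have h0 := Polytime.nil
  have h1 := Polytime.one
  have hN := Polytime.id.hd
  have hmap := Polytime.map (f := fun e => .cons (.cons .nil (.cons .one (.cons .nil e.hd)))
    (.cons .one (.cons .nil (.cons .nil e.tl.hd))))
    ((h0.cons (h1.cons (h0.cons hN))).cons (h1.cons (h0.cons (h0.cons Polytime.id.tl.hd))))
    Polytime.id.tl
  exact (h0.cons (h0.cons (h0.cons hN))).cons
    (((h0.cons (h0.cons (h1.cons hN))).cons (h1.cons (h0.cons (h0.cons hN)))).cons hmap)

theorem singleton_zero_eq (n : ℕ) : ({0} : Finset (Fin (n + 3))) =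
    consSet true (consSet false (consSet false ∅)) := by
  rw [consSet_false_empty, consSet_false_empty, consSet_true_empty]

theorem baseData_code {K : BaseClass}
    (hK : ∀ (n : ℕ) (B : Set (Implication (Fin n))), IsHeightTwoBase B → K n B)
    (H : HypergraphInst) : baseData (familyCode H.n H.edges) = (H.toBase hK).code := by
  simp only [baseData, familyCode, BaseInst.code, HypergraphInst.toBase, HypergraphInst.ext,
    Data.hd_cons, Data.tl_cons, Data.toList_ofList, ofNat_succ, implicationCode, List.map_cons,
    Data.ofList_cons, List.map_map, Function.comp_def, singleton_zero_eq, ofFinset_consSet,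
    ofFinset_empty, Data.ofBool]

/-- The vertex set of the hypergraph that is given by an irreducible closed set, if any. -/
def decodeSet {n : ℕ} (M : Finset (Fin (n + 3))) : Option (Finset (Fin n)) :=
  if 0 ∉ M ∧ 1 ∈ M then some (tailSet (tailSet (tailSet M))) else none

theorem decodeSet_consSet {n : ℕ} (a b c : Bool) (A : Finset (Fin n)) :
    decodeSet (consSet a (consSet b (consSet c A))) =
      if a = false ∧ b = true then some A else none := by
  simp [decodeSet]

/-- `decodeSet` on codes; the first argument is ignored. -/
def decodeSetData (d : Data) : Data :=
  .cond d.tl.hd .nil (.cond d.tl.tl.hd (.cons .nil d.tl.tl.tl.tl) .nil)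

theorem polytime_decodeSetData : Polytime decodeSetData :=
  Polytime.id.tl.hd.cond .nil (Polytime.id.tl.tl.hd.cond
    (Polytime.nil.cons Polytime.id.tl.tl.tl.tl) .nil)

theorem decodeSetData_code {n : ℕ} (d : Data) (M : Finset (Fin (n + 3))) :
    decodeSetData (.cons d (Data.ofFinset M)) =
      Data.ofOption ((decodeSet M).map Data.ofFinset) := by
  obtain ⟨a, M, rfl⟩ := exists_consSet M
  obtain ⟨b, M, rfl⟩ := exists_consSet M
  obtain ⟨c, M, rfl⟩ := exists_consSet M
  rw [decodeSet_consSet]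
  cases a <;> cases b <;> simp [decodeSetData, Data.ofOption]

/-- Decoding the irreducible closed sets gives the maximal independent sets, and few of them are
rejected. -/
theorem decodeSet_spec {n : ℕ} {E : Set (Finset (Fin n))} {S : Set (Finset (Fin (n + 3)))}
    (h1 : irrAt (closedSets (starBase 0 (extEdges E))) 0 ⊆ S)
    (h2 : S ⊆ irr (closedSets (starBase 0 (extEdges E)))) :
    {y | ∃ x ∈ S, decodeSet x = some y} = MIS E ∧
    (∀ x ∈ S, ∀ x' ∈ S, ∀ y, decodeSet x = some y → decodeSet x' = some y → x = x') ∧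
    {x ∈ S | decodeSet x = none}.encard ≤ (n + 4 : ℕ) := by
  -- As `S` is only required to lie between the sets attached to `0` and all irreducible sets, the
  -- same argument serves `ACSEnum` and `ICSEnum`.
  rw [irr_starBase, irrAt_starBase] at h2
  rw [irrAt_starBase] at h1
  have key : ∀ x ∈ S, ∀ y, decodeSet x = some y →
      y ∈ MIS E ∧ x = consSet false (consSet true (consSet false y)) := by
    intro x hx y hy
    obtain ⟨a, M, rfl⟩ := exists_consSet x
    obtain ⟨b, M, rfl⟩ := exists_consSet M
    obtain ⟨c, M, rfl⟩ := exists_consSet M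
    rw [decodeSet_consSet] at hy
    split_ifs at hy with hab
    obtain ⟨rfl, rfl⟩ := hab
    obtain rfl := Option.some_inj.1 hy
    rcases h2 hx with h | ⟨x, hx0, h⟩
    · obtain ⟨-, rfl, h, -⟩ := of_maximal_indep_extEdges h
      exact ⟨h rfl, rfl⟩
    · have := Finset.ext_iff.1 h 0
      simp [hx0.symm] at this
  refine ⟨?_, ?_, ?_⟩
  · ext y
    constructor
    · rintro ⟨x, hx, hy⟩
      exact (key x hx y hy).1
    · intro hy
      exact ⟨_, h1 (maximal_indep_extEdges hy), by rw [decodeSet_consSet]; simp⟩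
  · intro x hx x' hx' y hy hy'
    rw [(key x hx y hy).2, (key x' hx' y hy').2]
  -- Rejected are at most the one maximal independent set without `1` and `n + 3` complements of
  -- singletons, which explains `n + 4`.
  · have hsub : {x ∈ S | decodeSet x = none} ⊆
        ((insert (consSet false (consSet false (consSet false Finset.univ)))
          (Finset.univ.image fun x : Fin (n + 3) => Finset.univ.erase x) :
          Finset (Finset (Fin (n + 3)))) : Set (Finset (Fin (n + 3)))) := by
      rintro x ⟨hx, hnone⟩
      rw [Finset.mem_coe, Finset.mem_insert]
      rcases h2 hx with h | ⟨x, hx0, h⟩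
      · left
        obtain ⟨a, M, rfl⟩ := exists_consSet x
        obtain ⟨b, M, rfl⟩ := exists_consSet M
        obtain ⟨c, M, rfl⟩ := exists_consSet M
        obtain ⟨rfl, rfl, -, h⟩ := of_maximal_indep_extEdges h
        rw [decodeSet_consSet] at hnone
        have hb : b = false := by simpa using hnone
        rw [hb, h hb]
      · right
        exact Finset.mem_image.2 ⟨x, Finset.mem_univ x, h.symm⟩
    refine (Set.encard_le_encard hsub).trans ?_
    rw [Set.encard_coe_eq_coe_finsetCard]
    refine Nat.cast_le.2 ((Finset.card_insert_le _ _).trans ?_)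
    have := Finset.card_image_le (s := Finset.univ)
      (f := fun x : Fin (n + 3) => Finset.univ.erase x)
    simp only [Finset.card_univ, Fintype.card_fin] at this
    omega

theorem HypergraphInst.size_toBase {K : BaseClass}
    (hK : ∀ (n : ℕ) (B : Set (Implication (Fin n))), IsHeightTwoBase B → K n B)
    (H : HypergraphInst) : (H.toBase hK).size = H.n + H.edges.length + 4 := by
  simp [BaseInst.size, HypergraphInst.toBase, HypergraphInst.ext]
  omega

theorem polyBounded_size_add (k : ℕ) :
    PolyBounded (fun H : HypergraphInst => H.n + H.edges.length)
      fun H => H.n + H.edges.length + k :=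
  (PolyBounded.self _).add (.const _ k)

theorem polyReduction_ICSEnum {K : BaseClass}
    (hK : ∀ (n : ℕ) (B : Set (Implication (Fin n))), IsHeightTwoBase B → K n B) :
    PolyReduction MISEnum (ICSEnum K) := by
  refine PolyReduction.of_polytime (Q := MISEnum) (P := ICSEnum K) (fun H => H.toBase hK)
    (fun H M => decodeSet (n := H.n) M) polytime_baseData polytime_decodeSetData
    (fun H => baseData_code hK H) (fun H M => decodeSetData_code (n := H.n) _ M)
    ((polyBounded_size_add 4).mono fun H => (H.size_toBase hK).le) polyBounded_familyCode
    (polyBounded_ofFinset (fun H => H.n + 3) (fun H => le_rfl)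
      (fun H (M : Finset (Fin (H.n + 3))) => M))
    (r := fun H => H.n + H.edges.length + 4) (polyBounded_size_add 4)
    fun (H : HypergraphInst) (S : Set (Finset (Fin (H.n + 3)))) hS => ?_
  have hS : S = irr (H.toBase hK).system := hS
  rw [H.system_toBase hK] at hS
  obtain ⟨h1, h2, h3⟩ := decodeSet_spec (n := H.n) (E := {e | e ∈ H.edges}) (S := S)
    ((irrAt_starBase_subset_irr).trans hS.superset) hS.subset
  exact ⟨h1, h2, h3.trans (Nat.cast_le.2 (by omega))⟩

theorem polyReduction_ACSEnum {K : BaseClass}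
    (hK : ∀ (n : ℕ) (B : Set (Implication (Fin n))), IsHeightTwoBase B → K n B) :
    PolyReduction MISEnum (ACSEnum K) := by
  -- The distinguished element is `0`, whose unary code is `nil`.
  refine PolyReduction.of_polytime (Q := MISEnum) (P := ACSEnum K)
    (fun H => ⟨H.toBase hK, (0 : Fin (H.n + 3))⟩)
    (fun H M => decodeSet (n := H.n) M) (polytime_baseData.cons .nil) polytime_decodeSetData
    (fun H => congrArg (Data.cons · .nil) (baseData_code hK H))
    (fun H M => decodeSetData_code (n := H.n) _ M)
    ((polyBounded_size_add 4).mono fun H => (H.size_toBase hK).le) polyBounded_familyCode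
    (polyBounded_ofFinset (fun H => H.n + 3) (fun H => le_rfl)
      (fun H (M : Finset (Fin (H.n + 3))) => M))
    (r := fun H => H.n + H.edges.length + 4) (polyBounded_size_add 4)
    fun (H : HypergraphInst) (S : Set (Finset (Fin (H.n + 3)))) hS => ?_
  have hS : S = irrAt (H.toBase hK).system (0 : Fin (H.n + 3)) := hS
  rw [H.system_toBase hK] at hS
  obtain ⟨h1, h2, h3⟩ := decodeSet_spec (n := H.n) (E := {e | e ∈ H.edges}) (S := S)
    hS.superset (hS.subset.trans irrAt_starBase_subset_irr)
  exact ⟨h1, h2, h3.trans (Nat.cast_le.2 (by omega))⟩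

/-! ### Generating minimum bases -/

section MinimalEdges

variable {n : ℕ}

theorem compl_consSet (b : Bool) (A : Finset (Fin n)) :
    (consSet b A)ᶜ = consSet (!b) Aᶜ := by
  ext i
  refine Fin.cases ?_ (fun i => ?_) i <;> simp

theorem insert_zero_consSet (b : Bool) (A : Finset (Fin n)) :
    insert 0 (consSet b A) = consSet true A := by
  ext i
  refine Fin.cases ?_ (fun i => ?_) i <;> simp [Fin.succ_ne_zero]

/-- The inclusion-wise minimal members of a list of sets. -/
def minimalMembers (l : List (Finset (Fin n))) : List (Finset (Fin n)) :=
  l.filter fun e => l.all fun e' => !decide (e' ⊆ e) || decide (e ⊆ e')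

theorem mem_minimalMembers {l : List (Finset (Fin n))} {e : Finset (Fin n)} :
    e ∈ minimalMembers l ↔ Minimal (· ∈ {e | e ∈ l}) e := by
  simp only [minimalMembers, List.mem_filter, List.all_eq_true, Bool.or_eq_true,
    Bool.not_eq_true', decide_eq_false_iff_not, decide_eq_true_eq, Minimal, Set.mem_ofPred_eq,
    imp_iff_not_or]

end MinimalEdges

/-- The irreducible closed sets of the closure system whose closed sets without `0` contain no
minimal hitting set of the extended hypergraph. -/
def HypergraphInst.irrs (H : HypergraphInst) : List (Finset (Fin (H.n + 3))) :=
  (coatomList (H.n + 2)).map (consSet true) ++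
    consSet false (consSet true (consSet false Finset.univ)) ::
      (minimalMembers H.edges).map fun e => consSet false (consSet false (consSet true eᶜ))

theorem HypergraphInst.nodup_irrs (H : HypergraphInst) : H.irrs.Nodup := by
  refine List.nodup_append'.2 ⟨(nodup_coatomList _).map fun A B h => by simpa using h, ?_, ?_⟩
  · exact List.nodup_cons.2 ⟨by simp, (H.nodup.filter _).map fun e e' h => by simpa using h⟩
  · intro M hM hM'
    obtain ⟨A, -, rfl⟩ := List.mem_map.1 hM
    simp at hM'

/-- The coatoms containing `0` come from `irr_starBase`, the other sets by duality from the minimal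
edges of the extension; the edge `{2}` accounts for the separate entry. Nonminimal edges would yield
reducible sets, hence the filtering. -/
theorem HypergraphInst.irr_eq (H : HypergraphInst) :
    irr (closedSets (starBase (0 : Fin (H.n + 3)) (MHS (extEdges {e | e ∈ H.edges})))) =
      {M | M ∈ H.irrs} := by
  rw [irr_starBase, irrAt_hittingSystem zero_notMem_extEdges, Set.union_comm]
  ext M
  simp only [Set.mem_union, Set.mem_ofPred_eq, HypergraphInst.irrs, List.mem_append, List.mem_cons]
  refine or_congr ?_ ?_
  · simp only [List.mem_map, mem_coatomList]
    constructor
    · rintro ⟨x, hx, rfl⟩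
      obtain ⟨y, rfl⟩ := Fin.exists_succ_eq.2 hx
      exact ⟨_, ⟨y, rfl⟩, (univ_erase_succ y).symm⟩
    · rintro ⟨_, ⟨y, rfl⟩, rfl⟩
      exact ⟨y.succ, Fin.succ_ne_zero y, (univ_erase_succ y).symm⟩
  · simp only [minimal_mem_extEdges, List.mem_map, mem_minimalMembers]
    constructor
    · rintro ⟨e, rfl | ⟨e, he, rfl⟩, rfl⟩
      · left
        simp only [insert_zero_consSet, compl_consSet, Finset.compl_empty, Bool.not_true,
          Bool.not_false]
      · right
        exact ⟨e, he, by simp only [insert_zero_consSet, compl_consSet, Bool.not_true,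
          Bool.not_false]⟩
    · rintro (rfl | ⟨e, he, rfl⟩)
      · exact ⟨_, .inl rfl, by simp only [insert_zero_consSet, compl_consSet, Finset.compl_empty,
          Bool.not_true, Bool.not_false]⟩
      · exact ⟨_, .inr ⟨e, he, rfl⟩, by simp only [insert_zero_consSet, compl_consSet,
          Bool.not_true, Bool.not_false]⟩

/-- The closure system whose closed sets without `0` contain no minimal hitting set of the extended
hypergraph. -/
def HypergraphInst.toIrr {K : SystemClass}
    (hK : ∀ (n : ℕ) (C : Set (Finset (Fin n))), AdmitsHeightTwoBase C → K n C)
    (H : HypergraphInst) : IrrInst K where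
  n := H.n + 3
  irrs := H.irrs
  nodup := H.nodup_irrs
  system := closedSets (starBase 0 (MHS (extEdges {e | e ∈ H.edges})))
  isClosureSystem := (isConvexGeometry_starBase (empty_notMem_MHS extEdges_nonempty)).1
  irr_eq := H.irr_eq
  -- The base that witnesses membership may be exponentially large; it has to exist but is never
  -- computed.
  mem := hK _ _ ⟨_, isHeightTwoBase_starBase (notMem_of_mem_MHS zero_notMem_extEdges)
    (MHS_nonempty empty_notMem_extEdges) (empty_notMem_MHS extEdges_nonempty), rfl⟩

/-- Whether the set `d.hd` is a minimal member of the family with code `d.tl`. -/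
def isMinimalData (d : Data) : Data :=
  .ofBool (d.tl.tl.toList.all fun x =>
    ((x.subset d.hd).cond (d.hd.subset x) .one).toBool)

theorem polytime_isMinimalData : Polytime isMinimalData :=
  Polytime.all (f := fun e => (e.hd.subset e.tl.hd).cond (e.tl.hd.subset e.hd) .one)
    Polytime.id.tl.tl ((Polytime.id.hd.subset Polytime.id.tl.hd).cond
      (Polytime.id.tl.hd.subset Polytime.id.hd) .one)

/-- The code of `H.toIrr` as a function of the code of `H`. -/
def irrsData (d : Data) : Data :=
  .cons (.cons .nil (.cons .nil (.cons .nil d.hd)))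
    (.ofList ((Data.ofList ((Data.cons .nil (.cons .nil d.hd)).coatoms.toList.map
        fun x => .cons .one x)).toList ++
      (Data.cons (.cons .nil (.cons .one (.cons .nil d.hd.compl)))
        (.ofList ((Data.ofList (d.tl.toList.filter
          fun x => (isMinimalData (.cons x d)).toBool)).toList.map
            fun x => .cons .nil (.cons .nil (.cons .one x.compl))))).toList))

theorem polytime_irrsData : Polytime irrsData := by
  have h0 := Polytime.nil
  have h1 := Polytime.one
  have hN := Polytime.id.hd
  have hmin := Polytime.filter Polytime.id.tl polytime_isMinimalData
  have hmap := Polytime.map (f := fun e => .cons .nil (.cons .nil (.cons .one e.hd.compl)))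
    (h0.cons (h0.cons (h1.cons hN.compl))) hmin
  have hco := Polytime.map (f := fun e => .cons .one e.hd) (h1.cons hN)
    (h0.cons (h0.cons hN)).coatoms
  exact (h0.cons (h0.cons (h0.cons hN))).cons
    (hco.append ((h0.cons (h1.cons (h0.cons hN.compl))).cons hmap))

theorem isMinimalData_code {n : ℕ} (l : List (Finset (Fin n))) (e : Finset (Fin n)) :
    (isMinimalData (.cons (Data.ofFinset e) (familyCode n l))).toBool =
      l.all fun e' => !decide (e' ⊆ e) || decide (e ⊆ e') := by
  simp only [isMinimalData, familyCode, Data.hd_cons, Data.tl_cons, Data.toList_ofList,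
    Data.toBool_ofBool, List.all_map, Function.comp_def, subset_ofFinset, Data.cond_ofBool]
  congr 1
  funext e'
  by_cases h : e' ⊆ e
  · simp [h]
  · simp [h, Data.toBool]

theorem irrsData_code (H : HypergraphInst) :
    irrsData (familyCode H.n H.edges) = familyCode (H.n + 3) H.irrs := by
  have h1 : ∀ n : ℕ, Data.cons .nil (.cons .nil (Data.ofNat n)) = Data.ofNat (n + 2) :=
    fun _ => rfl
  have h2 : (Data.ofList (H.edges.map Data.ofFinset)).toList.filter
      (fun x => (isMinimalData (.cons x (familyCode H.n H.edges))).toBool) =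
      (minimalMembers H.edges).map Data.ofFinset := by
    rw [Data.toList_ofList, List.filter_map, minimalMembers]
    simp only [Function.comp_def, isMinimalData_code]
  have h3 : (Data.ofNat H.n).compl = Data.ofFinset (Finset.univ : Finset (Fin H.n)) := by
    rw [← ofFinset_empty, compl_ofFinset, Finset.compl_empty]
  have htl : (familyCode H.n H.edges).tl = Data.ofList (H.edges.map Data.ofFinset) := rfl
  have hhd : (familyCode H.n H.edges).hd = Data.ofNat H.n := rfl
  rw [irrsData, htl, hhd, h2, h1, coatoms_ofNat, h3]
  simp only [familyCode, HypergraphInst.irrs, List.map_append, List.map_cons, List.map_map,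
    Data.toList_ofList, Data.toList_cons, Function.comp_def, ofFinset_consSet, compl_ofFinset,
    Data.ofBool, ofNat_succ]

/-- The vertex set of the hypergraph that is given by an implication, if any. -/
def decodeImplication {n : ℕ} (i : Implication (Fin (n + 3))) : Option (Finset (Fin n)) :=
  if 1 ∈ i.prem then none else some (tailSet (tailSet (tailSet i.prem)))

/-- `decodeImplication` on codes; the first argument is ignored. -/
def decodeImplicationData (d : Data) : Data :=
  .cond d.tl.hd.tl.hd .nil (.cons .nil d.tl.hd.tl.tl.tl)

theorem polytime_decodeImplicationData : Polytime decodeImplicationData :=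
  Polytime.id.tl.hd.tl.hd.cond .nil (Polytime.nil.cons Polytime.id.tl.hd.tl.tl.tl)

theorem decodeImplicationData_code {n : ℕ} (d : Data) (i : Implication (Fin (n + 3))) :
    decodeImplicationData (.cons d (implicationCode i)) =
      Data.ofOption ((decodeImplication i).map Data.ofFinset) := by
  obtain ⟨M, B⟩ := i
  obtain ⟨a, M, rfl⟩ := exists_consSet M
  obtain ⟨b, M, rfl⟩ := exists_consSet M
  obtain ⟨c, M, rfl⟩ := exists_consSet M
  cases b <;> simp [decodeImplicationData, decodeImplication, implicationCode, Data.ofOption]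

/-- Decoding the implications of a unit-minimum base gives the minimal hitting sets, and at most
one implication is rejected. -/
theorem decodeImplication_spec {n : ℕ} {E : Set (Finset (Fin n))}
    {S : Set (Implication (Fin (n + 3)))}
    (hS : IsUnitMinimumBase S (closedSets (starBase 0 (MHS (extEdges E))))) :
    {y | ∃ x ∈ S, decodeImplication x = some y} = MHS E ∧
    (∀ x ∈ S, ∀ x' ∈ S, ∀ y, decodeImplication x = some y → decodeImplication x' = some y →
      x = x') ∧
    {x ∈ S | decodeImplication x = none}.encard ≤ (1 : ℕ) := by
  have hanti : ∀ e ∈ MHS (extEdges E), ∀ e' ∈ MHS (extEdges E), e ⊆ e' → e = e' := by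
    intro e he e' he' h
    rw [mem_MHS] at he he'
    exact he'.eq_of_le he.prop h
  -- By uniqueness, whichever minimum base is produced is this one.
  rw [eq_starBase_of_isUnitMinimumBase (notMem_of_mem_MHS zero_notMem_extEdges) hanti hS]
  have key : ∀ x ∈ starBase 0 (MHS (extEdges E)), ∀ y, decodeImplication x = some y →
      y ∈ MHS E ∧ x = ⟨consSet false (consSet false (consSet true y)), {0}⟩ := by
    rintro _ ⟨M, hM, rfl⟩ y hy
    obtain ⟨a, M, rfl⟩ := exists_consSet M
    obtain ⟨b, M, rfl⟩ := exists_consSet M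
    obtain ⟨c, M, rfl⟩ := exists_consSet M
    obtain ⟨rfl, rfl, h, -⟩ := of_minimal_hitting_extEdges hM
    cases b with
    | true => simp [decodeImplication] at hy
    | false =>
      obtain rfl : M = y := by simpa [decodeImplication] using hy
      exact ⟨h rfl, rfl⟩
  refine ⟨?_, ?_, ?_⟩
  · ext y
    constructor
    · rintro ⟨x, hx, hy⟩
      exact (key x hx y hy).1
    · intro hy
      exact ⟨_, ⟨_, minimal_hitting_extEdges hy, rfl⟩, by simp [decodeImplication]⟩
  · intro x hx x' hx' y hy hy'
    rw [(key x hx y hy).2, (key x' hx' y hy').2]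
  -- Only `{1, 2} → 0` can be rejected.
  · refine (Set.encard_le_encard (t := {⟨consSet false (consSet true (consSet true ∅)), {0}⟩})
      ?_).trans (by simp)
    rintro _ ⟨⟨M, hM, rfl⟩, hnone⟩
    obtain ⟨a, M, rfl⟩ := exists_consSet M
    obtain ⟨b, M, rfl⟩ := exists_consSet M
    obtain ⟨c, M, rfl⟩ := exists_consSet M
    obtain ⟨rfl, rfl, -, h⟩ := of_minimal_hitting_extEdges hM
    have hb : b = true := by simpa [decodeImplication] using hnone
    rw [hb, h hb]
    rfl

/-- The premises of the base to be generated encode hitting sets, so the natural source here is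
`MHSEnum`; maximal independent sets follow by complementation. -/
theorem polyReduction_MIBGen {K : SystemClass}
    (hK : ∀ (n : ℕ) (C : Set (Finset (Fin n))), AdmitsHeightTwoBase C → K n C) :
    PolyReduction MHSEnum (MIBGen K) := by
  have hitem : PolyBounded (fun Hx : (H : HypergraphInst) × Implication (Fin (H.n + 3)) =>
      Hx.1.n + Hx.1.edges.length) fun Hx => (implicationCode Hx.2).size :=
    ((PolyBounded.const _ 1).add (polyBounded_ofFinset
      (β := fun H => Implication (Fin (H.n + 3))) (fun H => H.n + 3) (fun H => le_rfl)
        fun H i => i.prem)).add (polyBounded_ofFinset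
      (β := fun H => Implication (Fin (H.n + 3))) (fun H => H.n + 3) (fun H => le_rfl)
        fun H i => i.concl)
  -- Besides the `n + 3` elements there are `n + 2` coatoms, one set from the edge `{2}`, and at
  -- most one set per edge.
  have hsize : ∀ H : HypergraphInst,
      H.n + 3 + H.irrs.length ≤ 2 * (H.n + H.edges.length) + 6 := by
    intro H
    have h : (minimalMembers H.edges).length ≤ H.edges.length := List.length_filter_le _ _
    simp only [HypergraphInst.irrs, List.length_append, List.length_map, List.length_cons,
      length_coatomList]
    omega
  refine PolyReduction.of_polytime (Q := MHSEnum) (P := MIBGen K) (fun H => H.toIrr hK)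
    (fun H i => decodeImplication (n := H.n) i) polytime_irrsData polytime_decodeImplicationData
    irrsData_code (fun H i => decodeImplicationData_code (n := H.n) _ i)
    ((((PolyBounded.const _ 2).mul (.self _)).add (.const _ 6)).mono hsize)
    polyBounded_familyCode hitem (r := fun _ => 1) (.const _ 1)
    fun (H : HypergraphInst) (S : Set (Implication (Fin (H.n + 3)))) hS => ?_
  exact decodeImplication_spec (n := H.n) (E := {e | e ∈ H.edges}) hS

end EnumHardness

/-! ### The main theorem. -/

open EnumHardness EnumProblem in
theorem mainTheorem12 :
    (∀ K : BaseClass, (∀ (n : ℕ) (B : Set (Implication (Fin n))), IsHeightTwoBase B → K n B) →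
      AtLeastAsHard (ICSEnum K) MISEnum ∧ AtLeastAsHard (ICSEnum K) MHSEnum ∧
      AtLeastAsHard (ACSEnum K) MISEnum ∧ AtLeastAsHard (ACSEnum K) MHSEnum) ∧
    (∀ K : SystemClass, (∀ (n : ℕ) (C : Set (Finset (Fin n))), AdmitsHeightTwoBase C → K n C) →
      AtLeastAsHard (MIBGen K) MISEnum ∧ AtLeastAsHard (MIBGen K) MHSEnum) ∧
    (∀ (V : Type*) [Fintype V] [DecidableEq V] (E : Set (Finset V)),
      IsAcyclicBase (gadgetBase E) ∧
      irrAt (closedSets (gadgetBase E)) none =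
        (fun I => I.map Function.Embedding.some) '' MIS E ∧
      (E.Nonempty → ∅ ∉ E →
        HasHeight (gadgetBase E) 2 ∧ IsConvexGeometry (closedSets (gadgetBase E)))) := by
  refine ⟨fun K hK => ?_, fun K hK => ?_, fun V _ _ E => ⟨?_, irrAt_gadgetBase E, fun hne he => ?_⟩⟩
  · exact ⟨(polyReduction_ICSEnum hK).atLeastAsHard,
      (polyReduction_MHSEnum (polyReduction_ICSEnum hK)).atLeastAsHard,
      (polyReduction_ACSEnum hK).atLeastAsHard,
      (polyReduction_MHSEnum (polyReduction_ACSEnum hK)).atLeastAsHard⟩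
  · exact ⟨(polyReduction_MISEnum (polyReduction_MIBGen hK)).atLeastAsHard,
      (polyReduction_MIBGen hK).atLeastAsHard⟩
  · rw [gadgetBase_eq]
    exact isAcyclicBase_starBase none_notMem_of_mem_image
  · have he' : ∅ ∉ (fun e : Finset V => e.map Function.Embedding.some) '' E := by
      rintro ⟨e, h, h'⟩
      rw [Finset.map_eq_empty.1 h'] at h
      exact he h
    rw [gadgetBase_eq]
    exact ⟨hasHeight_starBase none_notMem_of_mem_image (hne.image _) he',
      isConvexGeometry_starBase he'⟩
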